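/- Let $K$ be a number field with ring of integers $\mathcal{O}_K$ and algebraic closure $K^c$, let $\Omega_K=\mathrm{Gal}(K^c/K)$, and let $G$ be a finite abelian group of odd order. Let $\mathrm{Hom}(\Omega_K,G)$ be the group, under pointwise multiplication, of continuous homomorphisms $h:\Omega_K\to G$ ($G$ discrete); it parametrizes the isomorphism classes of $G$-Galois $K$-algebras through $$h\mapsto K_h=\{a:G\to K^c \mid a(h(\omega)s)=\omega(a(s))\text{ for all }\omega\in\Omega_K,\ s\in G\},\qquad (s\cdot a)(t)=a(ts).$$ Put $K^h=(K^c)^{\ker h}$. Let $d(h)$ be the set of finite primes of $K$ that ramify in $K^h$. Call $h$ weakly ramified if the second ramification group (lower numbering) of $K^h/K$ at every finite prime of $K^h$ is trivial. For weakly ramified $h$, let $A^h$ be the fractional ideal of $K^h$ whose square is the inverse different of $K^h/K$, and let $A_h=\{a\in K_h\mid a(s)\in A^h\text{ for all }s\in G\}$, an $\mathcal{O}_KG$-module. Let $\mathrm{Cl}(\mathcal{O}_KG)$ be the locally free class group of $\mathcal{O}_KG$, that is (as $G$ is abelian) the group under $\otimes_{\mathcal{O}_KG}$ of isomorphism classes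 of finitely generated $\mathcal{O}_KG$-modules $M$ such that $\mathcal{O}_{K_v}\otimes_{\mathcal{O}_K}M\cong\mathcal{O}_{K_v}G$ as $\mathcal{O}_{K_v}G$-modules for every finite prime $v$ of $K$. Theorem 1.2. For every weakly ramified $h$ the ideal $A^h$ exists and $A_h$ is locally free of rank one over $\mathcal{O}_KG$, so that $\mathrm{gal}_A(h):=[A_h]\in\mathrm{Cl}(\mathcal{O}_KG)$ is defined. Moreover: (a) If $h\in\mathrm{Hom}(\Omega_K,G)$ is weakly ramified, then $h^{-1}$ is weakly ramified and $\mathrm{gal}_A(h^{-1})=\mathrm{gal}_A(h)^{-1}$. (b) If $h_1,h_2\in\mathrm{Hom}(\Omega_K,G)$ are weakly ramified and $d(h_1)\cap d(h_2)=\emptyset$, then $h_1h_2$ is weakly ramified and $\mathrm{gal}_A(h_1h_2)=\mathrm{gal}_A(h_1)\,\mathrm{gal}_A(h_2)$. -/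

import Mathlib

open scoped TensorProduct nonZeroDivisors
open NumberField IsDedekindDomain

namespace SqrtInvDiff

/-! ### The square root of the inverse different and ramification in an extension `L/K` -/

section Extension

variable (K L : Type*) [Field K] [NumberField K] [Field L] [NumberField L] [Algebra K L]

/-- The inverse different of `L/K`, a fractional ideal of `L`. -/
noncomputable def inverseDifferent : FractionalIdeal (𝓞 L)⁰ L :=
  (differentIdeal (𝓞 K) (𝓞 L) : FractionalIdeal (𝓞 L)⁰ L)⁻¹

open Classical in
/-- The square root of the inverse different of `L/K`: the fractional ideal of `L` (unique if it
exists) whose square is the inverse different. The value `0` is used if there is none. -/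
noncomputable def sqrtInverseDifferent : FractionalIdeal (𝓞 L)⁰ L :=
  if hA : ∃ A : FractionalIdeal (𝓞 L)⁰ L, A ^ 2 = inverseDifferent K L then hA.choose else 0

variable {L}

/-- The `n`-th ramification group (lower numbering) at a prime `P` of `L`:
all `σ ∈ Gal(L/K)` with `σ x ≡ x mod P ^ (n + 1)` for all `x ∈ 𝓞 L`. -/
def ramificationGroup (P : Ideal (𝓞 L)) (n : ℕ) : Subgroup Gal(L/K) :=
  (P ^ (n + 1)).inertia Gal(L/K)

end Extension

/-! ### Galois algebras -/

section GaloisAlgebra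

variable {K : Type*} [Field K] [NumberField K]
variable {G : Type*} [CommGroup G] [TopologicalSpace G] [DiscreteTopology G]

variable (K G) in
/-- `H¹(Ω_K, G) = Hom(Ω_K, G)`: continuous homomorphisms from the absolute Galois group of `K`
to the discrete abelian group `G`, a group under pointwise multiplication. It parametrizes the
isomorphism classes of `G`-Galois `K`-algebras. -/
abbrev GaloisHom : Type _ :=
  Gal(AlgebraicClosure K/K) →ₜ* G

/-- The field `K^h` fixed by the kernel of `h`. -/
noncomputable def fieldOf (h : GaloisHom K G) : IntermediateField K (AlgebraicClosure K) :=
  IntermediateField.fixedField h.toMonoidHom.ker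

instance (h : GaloisHom K G) : FiniteDimensional K (fieldOf h) := by
  have hopen : IsOpen (h.toMonoidHom.ker : Set Gal(AlgebraicClosure K/K)) := by
    have : (h.toMonoidHom.ker : Set Gal(AlgebraicClosure K/K)) = h ⁻¹' {1} := by
      ext x
      simp [MonoidHom.mem_ker]
    rw [this]
    exact (isOpen_discrete _).preimage h.continuous_toFun
  rw [← InfiniteGalois.isOpen_iff_finite]
  have hclosed : IsClosed (h.toMonoidHom.ker : Set Gal(AlgebraicClosure K/K)) :=
    Subgroup.isClosed_of_isOpen _ hopen
  have := InfiniteGalois.fixingSubgroup_fixedField (k := K) (K := AlgebraicClosure K)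
    ⟨h.toMonoidHom.ker, hclosed⟩
  have h2 : (fieldOf h).fixingSubgroup = h.toMonoidHom.ker := this
  rw [h2]
  exact hopen

instance (h : GaloisHom K G) : NumberField (fieldOf h) :=
  NumberField.of_module_finite K (fieldOf h)

/-- `h` is weakly ramified: all second ramification groups of `K^h/K` are trivial. -/
def IsWeaklyRamified (h : GaloisHom K G) : Prop :=
  ∀ P : Ideal (𝓞 (fieldOf h)), P.IsPrime → P ≠ ⊥ → ramificationGroup K P 2 = ⊥

/-- `d(h)`: the set of primes of `K` which are ramified in `K^h`, equivalently in `K_h`. -/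
def ramifiedPrimes (h : GaloisHom K G) : Set (HeightOneSpectrum (𝓞 K)) :=
  {v | ∃ P : Ideal (𝓞 (fieldOf h)),
    P.IsPrime ∧ P.LiesOver v.asIdeal ∧ P.ramificationIdx (𝓞 K) ≠ 1}

/-- The `G`-Galois `K`-algebra `K_h = Map_{Ω_K}(ʰG, K^c)`: all maps `a : G → K^c` such that
`a (h(ω) s) = ω (a s)` for all `ω ∈ Ω_K` and `s ∈ G`. -/
def galoisAlgebra (h : GaloisHom K G) : Subalgebra K (G → AlgebraicClosure K) where
  carrier := {a | ∀ (ω : Gal(AlgebraicClosure K/K)) (s : G), a (h ω * s) = ω (a s)}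
  mul_mem' ha hb ω s := by simp [ha ω s, hb ω s]
  add_mem' ha hb ω s := by simp [ha ω s, hb ω s]
  algebraMap_mem' r ω s := by simp

/-- `A_h = Map_{Ω_K}(ʰG, A^h)`, the square root of the inverse different of `K_h/K`: the maps in
`K_h` with values in the square root `A^h` of the inverse different of `K^h/K`. -/
noncomputable def sqrtLattice (h : GaloisHom K G) : Submodule (𝓞 K) (G → AlgebraicClosure K) where
  carrier := {a | a ∈ galoisAlgebra h ∧
    ∀ s : G, ∃ y ∈ sqrtInverseDifferent K (fieldOf h), (y : AlgebraicClosure K) = a s}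
  add_mem' := by
    rintro a b ⟨ha, ha'⟩ ⟨hb, hb'⟩
    refine ⟨add_mem ha hb, fun s ↦ ?_⟩
    obtain ⟨y, hy, hya⟩ := ha' s
    obtain ⟨z, hz, hzb⟩ := hb' s
    exact ⟨y + z, Submodule.add_mem _ hy hz, by simp [hya, hzb]⟩
  zero_mem' := ⟨zero_mem _, fun s ↦ ⟨0, Submodule.zero_mem _, by simp⟩⟩
  smul_mem' := by
    rintro r a ⟨ha, ha'⟩
    refine ⟨?_, fun s ↦ ?_⟩
    · rw [← algebraMap_smul K r a]
      exact Subalgebra.smul_mem _ ha _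
    · obtain ⟨y, hy, hya⟩ := ha' s
      refine ⟨algebraMap (𝓞 K) (𝓞 (fieldOf h)) r • y, Submodule.smul_mem _ _ hy, ?_⟩
      simp only [Pi.smul_apply, ← hya, Algebra.smul_def]
      rfl

/-- The action of `G` on `A_h`, given by `(s • a)(t) = a(ts)`. -/
noncomputable def sqrtRep (h : GaloisHom K G) : Representation (𝓞 K) G (sqrtLattice h) where
  toFun s :=
    { toFun := fun a ↦ ⟨fun t ↦ a.1 (t * s),
        fun ω t ↦ by simpa only [mul_assoc] using a.2.1 ω (t * s), fun t ↦ a.2.2 (t * s)⟩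
      map_add' := fun _ _ ↦ rfl
      map_smul' := fun _ _ ↦ rfl }
  map_one' := by
    ext a t
    simp
  map_mul' s s' := by
    ext a t
    simp [mul_assoc]

/-- `A_h` as a module over the group ring `𝓞_K G`. -/
abbrev SqrtModule (h : GaloisHom K G) : Type _ := (sqrtRep h).asModule

end GaloisAlgebra

/-! ### The locally free class group of `𝓞_K G` -/

section ClassGroup

variable (K : Type*) [Field K] [NumberField K] (G : Type*) [CommGroup G]

/-- The group ring `𝓞_K G`. -/
abbrev GroupRing : Type _ := MonoidAlgebra (𝓞 K) G

variable {K} in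
/-- The completed group ring `(𝓞_K G)_v = 𝓞_{K_v} G` at a prime `v`. -/
abbrev LocalGroupRing (v : HeightOneSpectrum (𝓞 K)) : Type _ :=
  MonoidAlgebra (v.adicCompletionIntegers K) G

variable {K} in
/-- The canonical map `𝓞_K G → 𝓞_{K_v} G`. -/
noncomputable def toLocal (v : HeightOneSpectrum (𝓞 K)) : GroupRing K G →+* LocalGroupRing G v :=
  MonoidAlgebra.mapRingHom G (algebraMap (𝓞 K) (v.adicCompletionIntegers K))

/-- The locally free class group `Cl(𝓞_K G)`: the group, under tensor product over the commutative
ring `𝓞_K G`, of isomorphism classes of invertible `𝓞_K G`-modules `M` whose completion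
`𝓞_{K_v} G ⊗ M` is free (of rank one) over `𝓞_{K_v} G` for every prime `v` of `K`. -/
noncomputable def LocallyFreeClassGroup : Subgroup (CommRing.Pic (GroupRing K G)) :=
  ⨅ v : HeightOneSpectrum (𝓞 K), (CommRing.Pic.mapRingHom (toLocal G v)).ker

/-- `M` is a locally free `𝓞_K G`-module (of rank one): it is finitely generated, and the
completion `M_v` is isomorphic to `𝓞_{K_v} G` for every prime `v` of `K`. -/
def IsLocallyFree (M : Type*) [AddCommGroup M] [Module (GroupRing K G) M] : Prop :=
  Module.Finite (GroupRing K G) M ∧ ∀ v : HeightOneSpectrum (𝓞 K),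
    letI := (toLocal G v).toAlgebra
    Nonempty ((LocalGroupRing G v ⊗[GroupRing K G] M) ≃ₗ[LocalGroupRing G v] LocalGroupRing G v)

variable {K G}

/-- `c` is the class of the module `M`. -/
def IsClassOf (c : LocallyFreeClassGroup K G)
    (M : Type*) [AddCommGroup M] [Module (GroupRing K G) M] : Prop :=
  Nonempty (M ≃ₗ[GroupRing K G] c.1.AsModule)

variable (K G)

open Classical in
/-- The class `cl(M)` of a module `M` in `Cl(𝓞_K G)`; the value `1` is used for modules that do not
have a class. -/
noncomputable def cl (M : Type*) [AddCommGroup M] [Module (GroupRing K G) M] : LocallyFreeClassGroup K G :=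
  if hM : ∃ c : LocallyFreeClassGroup K G, IsClassOf c M then hM.choose else 1

end ClassGroup

/-- `gal_A(h) = cl(A_h)`. -/
noncomputable def galA {K : Type*} [Field K] [NumberField K]
    {G : Type*} [CommGroup G] [TopologicalSpace G] [DiscreteTopology G]
    (h : GaloisHom K G) : LocallyFreeClassGroup K G :=
  cl K G (SqrtModule h)

end SqrtInvDiff

namespace SqrtInvDiff

set_option linter.unusedSectionVars false

/-! Everything takes place in the commutative algebra `K^c[G]`, where `a ∈ K_h` is written as `∑
a(t) t⁻¹`. Then `A_h` becomes an `𝓞_K G`-lattice `sqrtIdeal h`, and a product of equivariant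
elements for `h` and `h'` is equivariant for `h * h'`. The theorem thus reduces to identities
between lattices: `A_h A_{h⁻¹} = 𝓞_K G`, which gives invertibility and (a), and `A_{h₁h₂} = A_{h₁}
A_{h₂}`, which gives (b). Invertibility suffices for local freeness because the local group rings
are semilocal and have trivial Picard group.

The square root `A` exists because, by Hilbert's formula, the different of a weakly ramified
extension has exponent `(|G₀| - 1) + (|G₁| - 1)` at each prime, which is even in odd degree. The
inclusion `A_h A_{h⁻¹} ⊆ 𝓞_K G` is integrality of traces on `A² = D⁻¹`. For the converse, a proper
product would lie in a maximal ideal, so the sums `∑ Tr(α σβ) χ(σ)` would all vanish for some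
character `χ` to a finite residue field of characteristic `p`. The group `G₁` has exponent `p`, so
`χ` is trivial on it. This moves the vanishing down to the fixed field of `G₁`, which is tame over
`K` at the prime, and a comparison of valuations there is contradictory
(`exists_trace_sum_ne_zero`).

For (b), every prime is unramified for `h₁` or for `h₂`, so ramification groups in the compositum
can be compared, and the lattices of integral elements satisfy `O_{h₁h₂} = O_{h₁} O_{h₂}`. If `f ∈
A_{h₁} A_{h₂}` has a value `y`, then each `Tr(a y²)` is a coefficient of a product in `A_{h₁} A_{h₂}
A_{h₁⁻¹} A_{h₂⁻¹} = 𝓞_K G`. Hence `y² ∈ D⁻¹` and `y` lies in its square root (`sqrtIdeal_mul_le`).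
Invertibility turns this inclusion into equality. -/

open WithZero in
theorem pow_notMem_pow_succ {R : Type*} [CommRing R] [IsDedekindDomain R] {P : Ideal R}
    [hPp : P.IsPrime] (hP : P ≠ ⊥) {π : R} (hπ : π ∈ P) (hπ2 : π ∉ P ^ 2) (k : ℕ) :
    π ^ k ∉ P ^ (k + 1) := by
  let v : HeightOneSpectrum R := ⟨P, hPp, hP⟩
  have h0 : π ≠ 0 := fun h ↦ hπ2 (h ▸ Ideal.zero_mem _)
  have h1 : v.intValuation π = exp (-1 : ℤ) := by
    have ha := (v.intValuation_le_pow_iff_mem π 1).mpr (by simpa using hπ)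
    have hb : ¬ v.intValuation π ≤ exp (-((2 : ℕ) : ℤ)) :=
      mt (v.intValuation_le_pow_iff_mem π 2).mp hπ2
    rw [v.intValuation_if_neg h0] at ha hb ⊢
    rw [exp_le_exp] at ha hb
    rw [exp_inj]
    push_cast at ha hb
    omega
  intro h
  have h2 := (v.intValuation_le_pow_iff_mem _ _).mpr h
  rw [map_pow, h1, ← exp_nsmul, exp_le_exp] at h2
  simp at h2

theorem natCast_le_count_coe_iff {R : Type*} (K : Type*) [CommRing R] [IsDedekindDomain R] [Field K]
    [Algebra R K] [IsFractionRing R K] (v : HeightOneSpectrum R) {I : Ideal R} (hI : I ≠ ⊥) (n : ℕ) :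
    (n : ℤ) ≤ FractionalIdeal.count K v (I : FractionalIdeal R⁰ K) ↔ I ≤ v.asIdeal ^ n := by
  classical
  rw [FractionalIdeal.count_coe K v hI, ← Ideal.dvd_iff_le, ← Associates.mk_le_mk_iff_dvd,
    Associates.mk_pow, Associates.prime_pow_dvd_iff_le (Associates.mk_ne_zero.mpr hI)
      v.associates_irreducible, Nat.cast_le]

/-! ### Totally ramified primes: uniformizers and the different. -/

section TotallyRamified

variable {E L G : Type*} [Field E] [NumberField E] [Field L] [NumberField L] [Algebra E L]
  [Group G] [Finite G] [MulSemiringAction G (𝓞 L)] [IsGaloisGroup G (𝓞 E) (𝓞 L)]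

open scoped Pointwise in
/-- A prime with full inertia group is the only one above its restriction. -/
theorem eq_of_liesOver_of_inertia_eq_top {P Q : Ideal (𝓞 L)} [P.IsPrime] [Q.IsPrime]
    (hI : P.inertia G = ⊤) (hQ : P.under (𝓞 E) = Q.under (𝓞 E)) : Q = P := by
  obtain ⟨σ, hσ⟩ := Algebra.IsInvariant.exists_smul_of_under_eq (𝓞 E) (𝓞 L) G P Q hQ
  have h1 : σ ∈ P.inertia G := hI ▸ Subgroup.mem_top σ
  have h2 := Ideal.inertia_le_stabilizer P h1
  rw [hσ]
  exact h2

-- `P` is the only prime containing the extension of its restriction, so it is contained in the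
-- radical of that ideal.
open scoped Pointwise in
theorem exists_pow_le_map_under {P : Ideal (𝓞 L)} [hPp : P.IsPrime] (hP : P ≠ ⊥)
    (hI : P.inertia G = ⊤) :
    ∃ n : ℕ, P ^ n ≤ (P.under (𝓞 E)).map (algebraMap (𝓞 E) (𝓞 L)) := by
  have hp : (P.under (𝓞 E)).IsMaximal :=
    (inferInstance : (P.under (𝓞 E)).IsPrime).isMaximal (mt Ideal.eq_bot_of_comap_eq_bot hP)
  refine Ideal.exists_pow_le_of_le_radical_of_fg ?_ (IsNoetherian.noetherian P)
  rw [Ideal.radical_eq_sInf]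
  refine le_sInf fun Q ⟨hQ, hQp⟩ ↦ ?_
  refine (eq_of_liesOver_of_inertia_eq_top (E := E) (Q := Q) hI ?_).ge
  refine hp.eq_of_le (Ideal.IsPrime.under (𝓞 E) Q).ne_top ?_
  rwa [Ideal.map_le_iff_le_comap] at hQ

theorem inertiaDeg_eq_one_of_inertia_eq_top {P : Ideal (𝓞 L)} [hPp : P.IsPrime] (hP : P ≠ ⊥)
    (hI : P.inertia G = ⊤) : P.inertiaDeg (𝓞 E) = 1 := by
  have hp : (P.under (𝓞 E)) ≠ ⊥ := mt Ideal.eq_bot_of_comap_eq_bot hP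
  have : (P.under (𝓞 E)).IsMaximal := (inferInstance : (P.under (𝓞 E)).IsPrime).isMaximal hp
  have : Finite (𝓞 E ⧸ P.under (𝓞 E)) := Ring.HasFiniteQuotients.finiteQuotient hp
  have h := Ideal.ncard_primesOver_mul_card_inertia_mul_finrank (G := G) (P.under (𝓞 E)) P
  rw [hI, Subgroup.card_top] at h
  have hs : (P.under (𝓞 E)).primesOver (𝓞 L) = {P} := by
    refine Set.eq_singleton_iff_unique_mem.mpr ⟨⟨hPp, inferInstance⟩, ?_⟩
    rintro Q ⟨_, hQ⟩
    exact eq_of_liesOver_of_inertia_eq_top (E := E) hI hQ.over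
  rw [hs, Set.ncard_singleton, one_mul] at h
  exact Nat.eq_of_mul_eq_mul_left (Nat.card_pos (α := G)) (by simpa using h)

theorem ramificationIdx_eq_card_inertia (P : Ideal (𝓞 L)) [hPp : P.IsPrime] (hP : P ≠ ⊥) :
    P.ramificationIdx (𝓞 E) = Nat.card (P.inertia G) := by
  have hp : (P.under (𝓞 E)) ≠ ⊥ := mt Ideal.eq_bot_of_comap_eq_bot hP
  have : (P.under (𝓞 E)).IsMaximal := (inferInstance : (P.under (𝓞 E)).IsPrime).isMaximal hp
  have : Finite (𝓞 E ⧸ P.under (𝓞 E)) := Ring.HasFiniteQuotients.finiteQuotient hp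
  rw [Ideal.card_inertia_eq_ramificationIdxIn (P.under (𝓞 E)) P,
    Ideal.ramificationIdxIn_eq_ramificationIdx (P.under (𝓞 E)) P G]

theorem exists_sub_algebraMap_mem {P : Ideal (𝓞 L)} [hPp : P.IsPrime] (hP : P ≠ ⊥)
    (hI : P.inertia G = ⊤) (x : 𝓞 L) : ∃ a : 𝓞 E, x - algebraMap (𝓞 E) (𝓞 L) a ∈ P := by
  have hp : (P.under (𝓞 E)) ≠ ⊥ := mt Ideal.eq_bot_of_comap_eq_bot hP
  have : (P.under (𝓞 E)).IsMaximal := (inferInstance : (P.under (𝓞 E)).IsPrime).isMaximal hp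
  have : P.IsMaximal := hPp.isMaximal hP
  let := Ideal.Quotient.field (P.under (𝓞 E))
  have h := inertiaDeg_eq_one_of_inertia_eq_top (E := E) hP hI
  rw [Ideal.inertiaDeg_eq_of_isMaximal (P.under (𝓞 E)) P] at h
  have h2 := Subalgebra.bot_eq_top_of_finrank_eq_one h
  have h3 : (Ideal.Quotient.mk P x) ∈ (⊥ : Subalgebra (𝓞 E ⧸ P.under (𝓞 E)) (𝓞 L ⧸ P)) :=
    h2 ▸ Algebra.mem_top
  obtain ⟨y, hy⟩ := Algebra.mem_bot.mp h3
  obtain ⟨a, rfl⟩ := Ideal.Quotient.mk_surjective y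
  refine ⟨a, ?_⟩
  rw [← Ideal.Quotient.eq, ← hy]
  rfl

/-- If `P` is totally ramified over `E` and `π` is a uniformizer at `P`, then `𝓞 E[π]` and `𝓞 L`
agree locally at `P`. -/
theorem exists_notMem_forall_smul_mem_adjoin {P : Ideal (𝓞 L)} [hPp : P.IsPrime] (hP : P ≠ ⊥)
    (hI : P.inertia G = ⊤) {π : 𝓞 L} (hπ : π ∈ P) (hπ2 : π ∉ P ^ 2) :
    ∃ c : 𝓞 E, algebraMap (𝓞 E) (𝓞 L) c ∉ P ∧ ∀ x : 𝓞 L, c • x ∈ Algebra.adjoin (𝓞 E) {π} := by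
  set N : Submodule (𝓞 E) (𝓞 L) := Subalgebra.toSubmodule (Algebra.adjoin (𝓞 E) {π}) with hN
  set p := P.under (𝓞 E)
  -- `π`-adic expansion: since the residue fields agree, each digit can be taken in `𝓞 E`.
  have step (k : ℕ) : ∀ x : 𝓞 L, ∃ y ∈ N, x - y ∈ P ^ k := by
    induction k with
    | zero => exact fun x ↦ ⟨0, N.zero_mem, by simp⟩
    | succ k ih =>
      intro x
      obtain ⟨y, hy, hxy⟩ := ih x
      obtain ⟨b, w, hw, hzw⟩ := Ideal.exists_mul_add_mem_pow_succ hP (π ^ k) (x - y)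
        (Ideal.pow_mem_pow hπ k) (pow_notMem_pow_succ hP hπ hπ2 k) hxy
      obtain ⟨a, ha⟩ := exists_sub_algebraMap_mem (E := E) hP hI b
      refine ⟨y + a • π ^ k, N.add_mem hy (N.smul_mem a ?_), ?_⟩
      · exact Subalgebra.pow_mem _ (Algebra.self_mem_adjoin_singleton (𝓞 E) π) k
      · have : x - (y + a • π ^ k) = (b - algebraMap (𝓞 E) (𝓞 L) a) * π ^ k + w := by
          rw [Algebra.smul_def]
          linear_combination -hzw
        rw [this]
        refine Ideal.add_mem _ ?_ hw
        rw [pow_succ']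
        exact Ideal.mul_mem_mul ha (Ideal.pow_mem_pow hπ k)
  -- With `P ^ n ⊆ p 𝓞_L`, the expansion gives `𝓞_L / N = p (𝓞_L / N)`. Nakayama yields `r ≡ 1 mod
  -- p` that kills the quotient.
  obtain ⟨n, hn⟩ := exists_pow_le_map_under (E := E) hP hI
  obtain ⟨r, hr, hr'⟩ := Submodule.exists_sub_one_mem_and_smul_eq_zero_of_fg_of_le_smul p
    (⊤ : Submodule (𝓞 E) (𝓞 L ⧸ N)) Module.Finite.fg_top (by
      rintro x -
      obtain ⟨x, rfl⟩ := N.mkQ_surjective x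
      obtain ⟨y, hy, hxy⟩ := step n x
      have h1 : x - y ∈ p • (⊤ : Submodule (𝓞 E) (𝓞 L)) := by
        rw [Ideal.smul_top_eq_map]
        exact hn hxy
      have h2 := Submodule.mem_map_of_mem (f := N.mkQ) h1
      rw [Submodule.map_smul'', Submodule.map_top, Submodule.range_mkQ, map_sub,
        (by simpa using hy : N.mkQ y = 0), sub_zero] at h2
      exact h2)
  refine ⟨r, fun h ↦ ?_, fun x ↦ ?_⟩
  · refine (inferInstance : p.IsPrime).ne_top ((Ideal.eq_top_iff_one _).mpr ?_)
    have : r ∈ p := h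
    simpa using Ideal.sub_mem _ this hr
  · have := hr' (N.mkQ x) trivial
    rwa [← map_smul, Submodule.mkQ_apply, Submodule.Quotient.mk_eq_zero] at this

/-- Membership of an element of the Galois group in the ramification groups of a totally ramified
prime can be tested on a uniformizer. -/
theorem mem_inertia_pow_iff (E : Type*) [Field E] [NumberField E] [Algebra E L]
    [IsGaloisGroup G (𝓞 E) (𝓞 L)] {P : Ideal (𝓞 L)} [hPp : P.IsPrime] (hP : P ≠ ⊥)
    (hI : P.inertia G = ⊤) {π : 𝓞 L} (hπ : π ∈ P) (hπ2 : π ∉ P ^ 2) (n : ℕ) (σ : G) :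
    σ ∈ (P ^ n).inertia G ↔ σ • π - π ∈ P ^ n := by
  refine ⟨fun h ↦ h π, fun h x ↦ ?_⟩
  obtain ⟨c, hc, hcx⟩ := exists_notMem_forall_smul_mem_adjoin (E := E) hP hI hπ hπ2
  have h1 : ∀ y ∈ Algebra.adjoin (𝓞 E) {π}, σ • y - y ∈ P ^ n := by
    intro y hy
    induction hy using Algebra.adjoin_induction with
    | mem y hy => rwa [Set.mem_singleton_iff.mp hy]
    | algebraMap r => simp
    | add y z _ _ hy hz =>
      rw [smul_add, add_sub_add_comm]
      exact Ideal.add_mem _ hy hz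
    | mul y z _ _ hy hz =>
      have : σ • (y * z) - y * z = (σ • y - y) * (σ • z) + y * (σ • z - z) := by
        rw [smul_mul']; ring
      rw [this]
      exact Ideal.add_mem _ (Ideal.mul_mem_right _ _ hy) (Ideal.mul_mem_left _ _ hz)
  -- The element `c` is fixed by `σ` and is a unit at `P`, so it can be cancelled.
  have h2 := h1 _ (hcx x)
  rw [smul_comm, ← smul_sub, Algebra.smul_def] at h2
  exact (Ideal.IsPrime.mul_mem_pow P h2).resolve_left hc

/-- The different of a totally ramified prime in terms of a uniformizer. -/
theorem exists_mul_differentIdeal_eq_span_prod [DecidableEq G] [Fintype G]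
    {P : Ideal (𝓞 L)} [hPp : P.IsPrime]
    (hP : P ≠ ⊥) (hI : P.inertia G = ⊤) {π : 𝓞 L} (hπ : π ∈ P) (hπ2 : π ∉ P ^ 2)
    (hinj : ∀ σ : G, σ • π = π → σ = 1) :
    ∃ I : Ideal (𝓞 L), ¬ I ≤ P ∧ I * differentIdeal (𝓞 E) (𝓞 L) =
      Ideal.span {∏ σ ∈ Finset.univ.erase (1 : G), (π - σ • π)} := by
  obtain ⟨c, hc, hcx⟩ := exists_notMem_forall_smul_mem_adjoin (E := E) hP hI hπ hπ2
  have hc0 : algebraMap (𝓞 E) (𝓞 L) c ≠ 0 := fun h ↦ hc (h ▸ P.zero_mem)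
  -- The conductor of `𝓞_E[π]` contains `c ∉ P`. Its product with the different is generated by
  -- `f'(π)`, with `f` the minimal polynomial of `π`.
  refine ⟨conductor (𝓞 E) π, fun h ↦ hc (h ?_), ?_⟩
  · rw [mem_conductor_iff]
    intro b
    rw [← Algebra.smul_def]
    exact hcx b
  rw [conductor_mul_differentIdeal (𝓞 E) E L π]
  · congr 2
    set f := minpoly (𝓞 E) π
    have hint : IsIntegral (𝓞 E) π := Algebra.IsIntegral.isIntegral π
    have hfm : f.Monic := minpoly.monic hint
    -- The conjugates of `π` are distinct roots of `f`; conversely `∏ (X - σπ)` has coefficients in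
    -- `𝓞 E` and vanishes at `π`. So the two agree.
    have hdvd1 : MulSemiringAction.charpoly G π ∣ f.map (algebraMap (𝓞 E) (𝓞 L)) := by
      have h1 := Multiset.prod_X_sub_C_dvd_iff_le_roots (hfm.map (algebraMap (𝓞 E) (𝓞 L))).ne_zero
        (Finset.univ.val.map fun σ : G ↦ σ • π)
      rw [Multiset.map_map] at h1
      refine h1.mpr ((Multiset.le_iff_subset ?_).mpr fun y hy ↦ ?_)
      · refine (Multiset.nodup_map_iff_of_injective fun σ τ h ↦ ?_).mpr Finset.univ.nodup
        have := hinj (τ⁻¹ * σ) (by rw [mul_smul]; exact inv_smul_eq_iff.mpr h)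
        exact (inv_mul_eq_one.mp this).symm
      · obtain ⟨σ, -, rfl⟩ := Multiset.mem_map.mp hy
        rw [Polynomial.mem_roots (hfm.map _).ne_zero, Polynomial.IsRoot, Polynomial.eval_map,
          ← Polynomial.aeval_def]
        have h2 : Polynomial.aeval (MulSemiringAction.toAlgHom (𝓞 E) (𝓞 L) σ π) f = 0 := by
          rw [Polynomial.aeval_algHom_apply, minpoly.aeval, map_zero]
        exact h2
    have hdvd2 : f.map (algebraMap (𝓞 E) (𝓞 L)) ∣ MulSemiringAction.charpoly G π := by
      obtain ⟨g, hg⟩ := (Polynomial.mem_lifts _).mp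
        (Algebra.IsInvariant.charpoly_mem_lifts (𝓞 E) (𝓞 L) G π)
      rw [← hg]
      refine Polynomial.map_dvd _ (minpoly.isIntegrallyClosed_dvd hint ?_)
      rw [Polynomial.aeval_def, ← Polynomial.eval_map, hg, MulSemiringAction.eval_charpoly]
    have heq : f.map (algebraMap (𝓞 E) (𝓞 L)) = MulSemiringAction.charpoly G π :=
      Polynomial.eq_of_monic_of_associated (hfm.map _) (MulSemiringAction.monic_charpoly G π)
        (associated_of_dvd_dvd hdvd2 hdvd1)
    rw [Polynomial.aeval_def, ← Polynomial.eval_map, ← Polynomial.derivative_map, heq,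
      MulSemiringAction.charpoly_eq, ← Finset.mul_prod_erase _ _ (Finset.mem_univ (1 : G))]
    simp [Polynomial.derivative_mul, Polynomial.eval_prod]
  -- This is `L = E(π)`: a multiple of `x` by a nonzero `y` is integral, and a further multiple by
  -- `c` lies in `𝓞_E[π]`.
  · refine eq_top_iff.mpr fun x _ ↦ ?_
    have := IsLocalization.isAlgebraic E (nonZeroDivisors (𝓞 E))
    have := Algebra.IsAlgebraic.trans (𝓞 E) E L
    obtain ⟨y, hy0, hy⟩ := (Algebra.IsAlgebraic.isAlgebraic (R := 𝓞 E) x).exists_integral_multiple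
    obtain ⟨z, hz⟩ := (IsIntegralClosure.isIntegral_iff (A := 𝓞 L)).mp hy
    have h1 : algebraMap (𝓞 L) L (c • z) ∈ Algebra.adjoin E {algebraMap (𝓞 L) L π} := by
      have h2 := hcx z
      generalize c • z = w at h2
      induction h2 using Algebra.adjoin_induction with
      | mem y hy => rw [Set.mem_singleton_iff.mp hy]; exact Algebra.self_mem_adjoin_singleton _ _
      | algebraMap r =>
        rw [← IsScalarTower.algebraMap_apply, IsScalarTower.algebraMap_apply (𝓞 E) E L]
        exact Subalgebra.algebraMap_mem _ _
      | add y z _ _ hy hz => rw [map_add]; exact add_mem hy hz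
      | mul y z _ _ hy hz => rw [map_mul]; exact mul_mem hy hz
    have h3 : algebraMap (𝓞 L) L (c • z) = (algebraMap (𝓞 E) E (c * y)) • x := by
      rw [algebraMap_smul, mul_smul, ← hz, Algebra.smul_def, map_mul,
        ← IsScalarTower.algebraMap_apply, Algebra.smul_def]
    have h4 : algebraMap (𝓞 E) E (c * y) ≠ 0 := by
      rw [Ne, FaithfulSMul.algebraMap_eq_zero_iff, mul_eq_zero, not_or]
      exact ⟨fun h ↦ hc0 (by rw [h, map_zero]), hy0⟩
    rw [h3] at h1
    have h5 := Subalgebra.smul_mem _ h1 (algebraMap (𝓞 E) E (c * y))⁻¹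
    rwa [smul_smul, inv_mul_cancel₀ h4, one_smul] at h5

/-- Hilbert's formula for the different at a totally and weakly ramified prime. -/
theorem count_differentIdeal_of_inertia_eq_top (E : Type*) [Field E] [NumberField E] [Algebra E L]
    [IsGaloisGroup G (𝓞 E) (𝓞 L)] (P : HeightOneSpectrum (𝓞 L))
    (hI : P.asIdeal.inertia G = ⊤) (h3 : (P.asIdeal ^ 3).inertia G = ⊥) :
    FractionalIdeal.count L P (differentIdeal (𝓞 E) (𝓞 L) : FractionalIdeal (𝓞 L)⁰ L) =
      ((Nat.card G : ℤ) - 1) + ((Nat.card ((P.asIdeal ^ 2).inertia G) : ℤ) - 1) := by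
  classical
  have := Fintype.ofFinite G
  obtain ⟨π, hπ⟩ := P.intValuation_exists_uniformizer
  have hπ1 : π ∈ P.asIdeal := by
    rw [← pow_one P.asIdeal, ← P.intValuation_le_pow_iff_mem, hπ]; rfl
  have hπ2 : π ∉ P.asIdeal ^ 2 := by
    rw [← P.intValuation_le_pow_iff_mem, hπ, WithZero.exp_le_exp]; simp
  have key (n : ℕ) (σ : G) : σ ∈ (P.asIdeal ^ n).inertia G ↔ σ • π - π ∈ P.asIdeal ^ n :=
    mem_inertia_pow_iff E P.ne_bot hI hπ1 hπ2 n σ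
  have hinj (σ : G) (h : σ • π = π) : σ = 1 := by
    rw [← Subgroup.mem_bot, ← h3, key, h, sub_self]
    exact Ideal.zero_mem _
  have hne (σ : G) (hσ : σ ≠ 1) : π - σ • π ≠ 0 := fun h ↦ hσ (hinj σ (sub_eq_zero.mp h).symm)
  obtain ⟨I, hIP, hI2⟩ := exists_mul_differentIdeal_eq_span_prod (E := E) P.ne_bot hI hπ1 hπ2 hinj
  have hI0 : I ≠ ⊥ := fun h ↦ hIP (h ▸ bot_le)
  have hD0 : differentIdeal (𝓞 E) (𝓞 L) ≠ ⊥ := differentIdeal_ne_bot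
  have hcI : FractionalIdeal.count L P (I : FractionalIdeal (𝓞 L)⁰ L) = 0 := by
    refine le_antisymm (not_lt.mp fun h ↦ hIP ?_) (FractionalIdeal.count_coe_nonneg L P I)
    have := (natCast_le_count_coe_iff L P hI0 1).mp (by exact_mod_cast h)
    rwa [pow_one] at this
  have hspan (s : Finset G) : Ideal.span {∏ σ ∈ s, (π - σ • π)} =
      ∏ σ ∈ s, Ideal.span {π - σ • π} := by
    induction s using Finset.induction_on with
    | empty => simp
    | insert a s ha ih =>
      rw [Finset.prod_insert ha, Finset.prod_insert ha, ← ih, Ideal.span_singleton_mul_span_singleton]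
  -- The valuation of `π - σπ` is at least 1 by total ramification and less than 3 by weak
  -- ramification.
  have hcount (σ : G) (hσ : σ ≠ 1) :
      FractionalIdeal.count L P (Ideal.span {π - σ • π} : FractionalIdeal (𝓞 L)⁰ L) =
        1 + if σ ∈ (P.asIdeal ^ 2).inertia G then 1 else 0 := by
    have h0 : Ideal.span {π - σ • π} ≠ ⊥ := by simpa using hne σ hσ
    have hk (n : ℕ) : (n : ℤ) ≤ FractionalIdeal.count L P
        (Ideal.span {π - σ • π} : FractionalIdeal (𝓞 L)⁰ L) ↔ σ ∈ (P.asIdeal ^ n).inertia G := by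
      rw [natCast_le_count_coe_iff L P h0, Ideal.span_singleton_le_iff_mem, key,
        ← neg_mem_iff, neg_sub]
    have k1 := (hk 1).mpr (by rw [pow_one, hI]; trivial)
    have k3 := mt (hk 3).mp (by rw [h3]; simpa using hσ)
    have k2 := hk 2
    push_cast at k1 k2 k3
    split_ifs with h <;> simp only [h, iff_true, iff_false] at k2 <;> omega
  have hprod (s : Finset G) (f : G → Ideal (𝓞 L)) : ((∏ σ ∈ s, f σ : Ideal (𝓞 L)) :
      FractionalIdeal (𝓞 L)⁰ L) = ∏ σ ∈ s, (f σ : FractionalIdeal (𝓞 L)⁰ L) :=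
    map_prod (FractionalIdeal.coeIdealHom (𝓞 L)⁰ L) f s
  have hmain := congrArg (fun J : Ideal (𝓞 L) ↦
    FractionalIdeal.count L P (J : FractionalIdeal (𝓞 L)⁰ L)) hI2
  simp only [hspan] at hmain
  rw [FractionalIdeal.coeIdeal_mul, FractionalIdeal.count_mul L P
    (FractionalIdeal.coeIdeal_ne_zero.mpr hI0) (FractionalIdeal.coeIdeal_ne_zero.mpr hD0), hcI,
    zero_add, hprod, FractionalIdeal.count_prod] at hmain
  · rw [hmain, Finset.sum_congr rfl fun σ hσ ↦ hcount σ (Finset.ne_of_mem_erase hσ),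
      Finset.sum_add_distrib, Finset.sum_const, Finset.card_erase_of_mem (Finset.mem_univ _),
      Finset.card_univ, Nat.card_eq_fintype_card, Finset.sum_boole, Finset.filter_erase,
      Finset.card_erase_of_mem (by simp)]
    have h1 : 0 < Fintype.card G := Fintype.card_pos
    have h2 : 0 < (Finset.univ.filter fun σ ↦ σ ∈ (P.asIdeal ^ 2).inertia G).card :=
      Finset.card_pos.mpr ⟨1, by simp⟩
    have h4 : Nat.card ((P.asIdeal ^ 2).inertia G) =
        (Finset.univ.filter fun σ ↦ σ ∈ (P.asIdeal ^ 2).inertia G).card := by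
      rw [Nat.card_eq_fintype_card, Fintype.card_subtype]
    rw [h4, nsmul_eq_mul, mul_one, Nat.cast_sub h1, Nat.cast_sub h2, Nat.cast_one]
  · intro σ hσ
    exact FractionalIdeal.coeIdeal_ne_zero.mpr (by simpa using hne σ (Finset.ne_of_mem_erase hσ))

end TotallyRamified

/-! ### Hilbert's formula and the square root of the inverse different. -/

section Hilbert

variable {K L : Type*} [Field K] [NumberField K] [Field L] [NumberField L] [Algebra K L]

instance [IsGalois K L] (H : Subgroup Gal(L/K)) :
    IsGaloisGroup H (𝓞 (FixedPoints.intermediateField H : IntermediateField K L)) (𝓞 L) :=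
  .of_isFractionRing _ _ _ (FixedPoints.intermediateField H : IntermediateField K L) L

theorem ramificationIdx_eq_one_iff_not_dvd_differentIdeal (P : Ideal (𝓞 L)) [P.IsPrime] :
    P.ramificationIdx (𝓞 K) = 1 ↔ ¬ P ∣ differentIdeal (𝓞 K) (𝓞 L) := by
  rw [not_dvd_differentIdeal_iff, Ideal.ramificationIdx_eq_one_iff]

theorem card_inertia_subgroup {G R : Type*} [Group G] [CommRing R] [MulSemiringAction G R]
    (H : Subgroup G) (I : Ideal R) (h : I.inertia G ≤ H) :
    Nat.card (I.inertia H) = Nat.card (I.inertia G) := by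
  have : I.inertia H = (I.inertia G).subgroupOf H := rfl
  rw [this]
  exact Nat.card_congr (Subgroup.subgroupOfEquivOfLe h).toEquiv

/-- **Hilbert's formula** for the different at a weakly ramified prime. -/
theorem count_differentIdeal [IsGalois K L] (P : HeightOneSpectrum (𝓞 L))
    (h3 : (P.asIdeal ^ 3).inertia Gal(L/K) = ⊥) :
    FractionalIdeal.count L P (differentIdeal (𝓞 K) (𝓞 L) : FractionalIdeal (𝓞 L)⁰ L) =
      ((Nat.card (P.asIdeal.inertia Gal(L/K)) : ℤ) - 1) +
        ((Nat.card ((P.asIdeal ^ 2).inertia Gal(L/K)) : ℤ) - 1) := by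
  set I := P.asIdeal.inertia Gal(L/K) with hI
  let E := (FixedPoints.intermediateField I : IntermediateField K L)
  have hItop : P.asIdeal.inertia I = ⊤ :=
    eq_top_iff.mpr fun σ _ ↦ Ideal.coe_mem_inertia.mp σ.2
  have hI3 : (P.asIdeal ^ 3).inertia I = ⊥ := by
    refine eq_bot_iff.mpr fun σ hσ ↦ ?_
    have := Ideal.coe_mem_inertia.mpr hσ
    rw [h3] at this
    exact Subtype.ext this
  have hle : (P.asIdeal ^ 2).inertia Gal(L/K) ≤ I :=
    fun σ hσ x ↦ Ideal.pow_le_self two_ne_zero (hσ x)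
  have h1 := count_differentIdeal_of_inertia_eq_top E P hItop hI3
  rw [card_inertia_subgroup I _ hle] at h1
  -- Both `e(P/K)` and `e(P/E)` equal the order of the inertia group, so its fixed field `E` is
  -- unramified over `K` below `P` and contributes nothing to the different at `P`.
  have hram : (P.asIdeal.under (𝓞 E)).ramificationIdx (𝓞 K) = 1 := by
    have h2 := Ideal.ramificationIdx_tower (R := 𝓞 K) (P.asIdeal.under (𝓞 E)) P.asIdeal
    rw [ramificationIdx_eq_card_inertia (E := E) (G := I) P.asIdeal P.ne_bot, hItop, Subgroup.card_top,
      ramificationIdx_eq_card_inertia (E := K) (G := Gal(L/K)) P.asIdeal P.ne_bot] at h2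
    exact Nat.eq_of_mul_eq_mul_right Nat.card_pos (by rw [one_mul]; exact h2.symm)
  rw [ramificationIdx_eq_one_iff_not_dvd_differentIdeal, Ideal.dvd_iff_le] at hram
  have hD1 : differentIdeal (𝓞 E) (𝓞 L) ≠ ⊥ := differentIdeal_ne_bot
  have hD2 : (differentIdeal (𝓞 K) (𝓞 E)).map (algebraMap (𝓞 E) (𝓞 L)) ≠ ⊥ :=
    Ideal.map_ne_bot_of_ne_bot differentIdeal_ne_bot
  have h0 : FractionalIdeal.count L P (((differentIdeal (𝓞 K) (𝓞 E)).map
      (algebraMap (𝓞 E) (𝓞 L)) : Ideal (𝓞 L)) : FractionalIdeal (𝓞 L)⁰ L) = 0 := by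
    refine le_antisymm (not_lt.mp fun h ↦ hram ?_) (FractionalIdeal.count_coe_nonneg L P _)
    have := (natCast_le_count_coe_iff L P hD2 1).mp (by exact_mod_cast h)
    rwa [pow_one, Ideal.map_le_iff_le_comap] at this
  rw [differentIdeal_eq_differentIdeal_mul_differentIdeal (𝓞 K) (𝓞 E) (𝓞 L),
    FractionalIdeal.coeIdeal_mul, FractionalIdeal.count_mul L P
    (FractionalIdeal.coeIdeal_ne_zero.mpr hD1) (FractionalIdeal.coeIdeal_ne_zero.mpr hD2), h0,
    add_zero, h1]

/-! ### Fractional ideals -/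

section FractionalIdeal

variable {R F : Type*} [CommRing R] [IsDedekindDomain R] [Field F] [Algebra R F] [IsFractionRing R F]

theorem exists_sq_eq_of_even_count {I : FractionalIdeal R⁰ F} (hI : I ≠ 0)
    (h : ∀ v : HeightOneSpectrum R, Even (FractionalIdeal.count F v I)) :
    ∃ A : FractionalIdeal R⁰ F, A ^ 2 = I := by
  choose c hc using h
  refine ⟨∏ᶠ v : HeightOneSpectrum R, (v.asIdeal : FractionalIdeal R⁰ F) ^ (c v), ?_⟩
  rw [finprod_pow]
  · conv_rhs => rw [← FractionalIdeal.finprod_heightOneSpectrum_factorization' F hI]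
    refine finprod_congr fun v ↦ ?_
    rw [hc v, ← zpow_natCast, ← zpow_mul]
    congr 1
    push_cast
    ring
  · refine Set.Finite.subset (Filter.eventually_cofinite.mp
      (FractionalIdeal.finite_factors I)) fun v hv h0 ↦ hv ?_
    have : c v = 0 := by have := hc v; omega
    simp [this]

/-- For `A ≠ 0`, the ideal `X = (x) A⁻¹` has `X² ⊆ R`, hence `X ⊆ R` as `R` is integrally closed.
This allows membership in `A` to be tested in the inverse different. -/
theorem mem_of_sq_mem_sq {A : FractionalIdeal R⁰ F} {x : F} (h : x ^ 2 ∈ A ^ 2) : x ∈ A := by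
  by_cases hA : A = 0
  · simpa [hA, FractionalIdeal.mem_zero_iff] using h
  rw [← FractionalIdeal.spanSingleton_le_iff_mem] at h ⊢
  set X := FractionalIdeal.spanSingleton R⁰ x * A⁻¹ with hX
  have h2 : X ^ 2 ≤ 1 := by
    have := mul_le_mul_left h (A⁻¹ ^ 2)
    rwa [← FractionalIdeal.spanSingleton_pow, ← mul_pow, ← mul_pow, mul_inv_cancel₀ hA,
      one_pow] at this
  have h1 : X ≤ 1 := by
    intro y hy
    have hy2 : y ^ 2 ∈ (1 : FractionalIdeal R⁰ F) :=
      h2 (by rw [sq, sq]; exact FractionalIdeal.mul_mem_mul hy hy)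
    obtain ⟨r, hr⟩ := (FractionalIdeal.mem_one_iff _).mp hy2
    obtain ⟨s, hs⟩ := IsIntegrallyClosed.isIntegral_iff.mp
      (IsIntegral.of_pow two_pos (hr ▸ isIntegral_algebraMap : IsIntegral R (y ^ 2)))
    exact (FractionalIdeal.mem_one_iff _).mpr ⟨s, hs⟩
  have := mul_le_mul_left h1 A
  rwa [hX, mul_assoc, inv_mul_cancel₀ hA, mul_one, one_mul] at this

end FractionalIdeal

section SquareRoot

theorem inverseDifferent_eq_dual : inverseDifferent K L =
    FractionalIdeal.dual (𝓞 K) K (1 : FractionalIdeal (𝓞 L)⁰ L) := by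
  rw [inverseDifferent, coeIdeal_differentIdeal (𝓞 K) K, inv_inv]

variable (K L) in
theorem inverseDifferent_ne_zero : inverseDifferent K L ≠ 0 :=
  inv_ne_zero (FractionalIdeal.coeIdeal_ne_zero.mpr differentIdeal_ne_bot)

theorem mem_inverseDifferent_iff {x : L} : x ∈ inverseDifferent K L ↔
    ∀ a : 𝓞 L, ∃ t : 𝓞 K, (t : K) = Algebra.trace K L (x * a) := by
  rw [inverseDifferent_eq_dual, FractionalIdeal.mem_dual (one_ne_zero (α := FractionalIdeal (𝓞 L)⁰ L))]
  simp [FractionalIdeal.mem_one_iff, Algebra.traceForm_apply]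

theorem sqrtInverseDifferent_sq_of_exists
    (h : ∃ A : FractionalIdeal (𝓞 L)⁰ L, A ^ 2 = inverseDifferent K L) :
    sqrtInverseDifferent K L ^ 2 = inverseDifferent K L := by
  rw [sqrtInverseDifferent, dif_pos h]
  exact h.choose_spec

/-- The square root of the inverse different exists in weakly ramified extensions of odd degree. -/
theorem sqrtInverseDifferent_sq [IsGalois K L] (hodd : Odd (Nat.card Gal(L/K)))
    (hw : ∀ P : HeightOneSpectrum (𝓞 L), (P.asIdeal ^ 3).inertia Gal(L/K) = ⊥) :
    sqrtInverseDifferent K L ^ 2 = inverseDifferent K L := by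
  refine sqrtInverseDifferent_sq_of_exists
    (exists_sq_eq_of_even_count (inverseDifferent_ne_zero K L) fun P ↦ ?_)
  rw [inverseDifferent, FractionalIdeal.count_inv, count_differentIdeal P (hw P), even_neg]
  -- Subgroups have odd order, so both terms of Hilbert's formula are even.
  have h (H : Subgroup Gal(L/K)) : Even ((Nat.card H : ℤ) - 1) := by
    have : Odd (Nat.card H) := hodd.of_dvd_nat (Subgroup.card_subgroup_dvd_card H)
    exact (Int.odd_coe_nat _ |>.mpr this).sub_odd odd_one
  exact (h _).add (h _)

end SquareRoot

end Hilbert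

/-! ### Dual bases for the trace form. -/

section DualBasis

variable (K M : Type*) [Field K] [NumberField K] [Field M] [NumberField M] [Algebra K M]

/-- `𝓞_M` is projective over `𝓞_K` but need not be free. The coordinates of a splitting of `𝓞_K^n →
𝓞_M` serve as a dual basis, and the trace form represents them by the `a i`. -/
theorem exists_finset_sum_trace_mul_eq : ∃ (n : ℕ) (a : Fin n → M) (b : Fin n → 𝓞 M),
    (∀ i, a i ∈ inverseDifferent K M) ∧
      ∀ x : M, ∑ i, algebraMap K M (Algebra.trace K M (a i * x)) * b i = x := by
  have : Module.Projective (𝓞 K) (𝓞 M) :=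
    have := Module.finitePresentation_of_finite (𝓞 K) (𝓞 M)
    Module.Flat.projective_of_finitePresentation
  obtain ⟨n, f, hf⟩ := Module.Finite.exists_fin' (𝓞 K) (𝓞 M)
  obtain ⟨s, hs⟩ := Module.projective_lifting_property f LinearMap.id hf
  have := IsIntegralClosure.isLocalization (𝓞 K) K M (𝓞 M)
  let j : 𝓞 M →ₗ[𝓞 K] M := (IsScalarTower.toAlgHom (𝓞 K) (𝓞 M) M).toLinearMap
  have : IsLocalizedModule (𝓞 K)⁰ j := isLocalizedModule_iff_isLocalization.mpr this
  let p (i : Fin n) : 𝓞 M →ₗ[𝓞 K] 𝓞 K :=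
    (LinearMap.proj i : (Fin n → 𝓞 K) →ₗ[𝓞 K] 𝓞 K) ∘ₗ s
  let φ (i : Fin n) : M →ₗ[K] K := IsLocalizedModule.mapExtendScalars (𝓞 K)⁰ j
    (Algebra.linearMap (𝓞 K) K) K (p i)
  have hφ (i : Fin n) (y : 𝓞 M) : φ i y = (s y i : K) :=
    IsLocalizedModule.map_apply (𝓞 K)⁰ j (Algebra.linearMap (𝓞 K) K) (p i) y
  let e := LinearMap.BilinForm.toDual (Algebra.traceForm K M) (traceForm_nondegenerate K M)
  have he (i : Fin n) (x : M) : Algebra.trace K M (e.symm (φ i) * x) = φ i x := by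
    rw [← Algebra.traceForm_apply, ← LinearMap.BilinForm.toDual_def (traceForm_nondegenerate K M)]
    exact LinearMap.congr_fun (e.apply_symm_apply (φ i)) x
  refine ⟨n, fun i ↦ e.symm (φ i), fun i ↦ f (Pi.single i 1), fun i ↦ ?_, fun x ↦ ?_⟩
  · rw [mem_inverseDifferent_iff]
    exact fun y ↦ ⟨s y i, by rw [he, hφ]⟩
  · simp only [he]
    have h1 : (∑ i, (φ i).smulRight ((f (Pi.single i 1) : 𝓞 M) : M)) = LinearMap.id := by
      refine LinearMap.restrictScalars_injective (𝓞 K) ?_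
      refine IsLocalizedModule.linearMap_ext (𝓞 K)⁰ j j ?_
      refine LinearMap.ext fun y ↦ ?_
      have h2 : y = ∑ i, s y i • f (Pi.single i 1) := by
        conv_lhs => rw [← LinearMap.id_apply (R := 𝓞 K) y, ← hs, LinearMap.comp_apply,
          pi_eq_sum_univ' (s y), map_sum]
        simp only [map_smul]
      have h3 := congrArg j h2
      rw [map_sum] at h3
      simp only [map_smul] at h3
      conv_rhs => rw [LinearMap.comp_apply, h3]
      simp only [LinearMap.comp_apply, LinearMap.restrictScalars_apply, LinearMap.sum_apply,
        LinearMap.smulRight_apply, LinearMap.id_apply]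
      refine Finset.sum_congr rfl fun i _ ↦ ?_
      have h4 : φ i (j y) = algebraMap (𝓞 K) K (s y i) := hφ i y
      rw [h4, algebraMap_smul]
      rfl
    have h2 := LinearMap.congr_fun h1 x
    simpa [Algebra.smul_def] using h2

-- Writing the traces as sums over the Galois group turns the dual basis identity into a relation
-- between automorphisms; Dedekind independence compares coefficients.
variable {K M} in
theorem sum_mul_apply_eq_ite [IsGalois K M] {n : ℕ} {a b : Fin n → M}
    (h : ∀ x : M, ∑ i, algebraMap K M (Algebra.trace K M (a i * x)) * b i = x)
    [DecidableEq Gal(M/K)] (g : Gal(M/K)) : ∑ i, a i * g (b i) = if g = 1 then 1 else 0 := by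
  have hli : LinearIndependent M (fun g : Gal(M/K) ↦ (g : M → M)) :=
    (linearIndependent_monoidHom M M).comp (fun g : Gal(M/K) ↦ ((g : M →* M)))
      fun g₁ g₂ h ↦ AlgEquiv.ext fun x ↦ DFunLike.congr_fun h x
  have h1 : ∑ g : Gal(M/K), (∑ i, g (a i) * b i) • (g : M → M) =
      ∑ g : Gal(M/K), (if g = 1 then (1 : M) else 0) • (g : M → M) := by
    funext x
    have hx := h x
    simp only [trace_eq_sum_automorphisms, map_mul] at hx
    simp only [Finset.sum_apply, Pi.smul_apply, smul_eq_mul, ite_mul, one_mul, zero_mul,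
      Finset.sum_ite_eq', Finset.mem_univ, if_true, AlgEquiv.one_apply]
    conv_rhs => rw [← hx]
    simp only [Finset.sum_mul]
    rw [Finset.sum_comm]
    exact Finset.sum_congr rfl fun _ _ ↦ Finset.sum_congr rfl fun _ _ ↦ by ring
  have h2 := Fintype.linearIndependent_iff.mp hli
    (fun g ↦ (∑ i, g (a i) * b i) - if g = 1 then 1 else 0)
    (by simp only [sub_smul, Finset.sum_sub_distrib, h1, sub_self]) g⁻¹
  have h3 := congrArg g (sub_eq_zero.mp h2)
  simpa [map_sum, apply_ite g] using h3

end DualBasis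

/-! ### The exponent of the first ramification group. -/

section Wild

variable {R G : Type*} [CommRing R] [Group G] [MulSemiringAction G R]

theorem smul_sub_self_mem_pow_three {P : Ideal R} {w : G} (hw : w ∈ (P ^ 2).inertia G) {y : R}
    (hy : y ∈ P ^ 2) : w • y - y ∈ P ^ 3 := by
  rw [sq] at hy
  induction hy using Submodule.mul_induction_on' with
  | mem_mul_mem a ha b hb =>
    have : w • (a * b) - a * b = (w • a - a) * (w • b - b) + (w • a - a) * b + (w • b - b) * a := by
      rw [smul_mul']; ring
    rw [this, pow_succ P 2]
    have hb' : w • b - b ∈ P := Ideal.pow_le_self two_ne_zero (hw b)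
    exact add_mem (add_mem (Ideal.mul_mem_mul (hw a) hb') (Ideal.mul_mem_mul (hw a) hb))
      (Ideal.mul_mem_mul (hw b) ha)
  | add x _ y _ hx hy =>
    rw [smul_add, add_sub_add_comm]
    exact add_mem hx hy

/-- If the second ramification group is trivial, then the first one has exponent `p`. -/
theorem pow_eq_one_of_mem_inertia_sq {P : Ideal R} (h3 : (P ^ 3).inertia G = ⊥) {w : G}
    (hw : w ∈ (P ^ 2).inertia G) {p : ℕ} (hp : (p : R) ∈ P) : w ^ p = 1 := by
  -- `w` acts trivially on `P² / P³`, so modulo `P³` the difference `w ^ k • x - x` is additive in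
  -- `k`.
  have key (k : ℕ) (x : R) : w ^ k • x - x - k * (w • x - x) ∈ P ^ 3 := by
    induction k with
    | zero => simp
    | succ k ih =>
      have : w ^ (k + 1) • x - x - ((k + 1 : ℕ) : R) * (w • x - x) =
          (w • (w ^ k • x - x) - (w ^ k • x - x)) + (w ^ k • x - x - k * (w • x - x)) := by
        rw [pow_succ', mul_smul, smul_sub]
        push_cast
        ring
      rw [this]
      exact add_mem (smul_sub_self_mem_pow_three hw (pow_mem hw k x)) ih
  rw [← Subgroup.mem_bot, ← h3]
  intro x
  have h1 := key p x
  have h2 : (p : R) * (w • x - x) ∈ P ^ 3 := by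
    rw [pow_succ']
    exact Ideal.mul_mem_mul hp (hw x)
  simpa using add_mem h1 h2

end Wild

/-! ### Valuations of extended ideals and of traces of ideals. -/

section Count

variable {M L : Type*} [Field M] [NumberField M] [Field L] [NumberField L] [Algebra M L]

theorem count_coe_eq_multiplicity {R : Type*} (K : Type*) [CommRing R] [IsDedekindDomain R]
    [Field K] [Algebra R K] [IsFractionRing R K] (v : HeightOneSpectrum R) {I : Ideal R}
    (hI : I ≠ ⊥) :
    FractionalIdeal.count K v (I : FractionalIdeal R⁰ K) = multiplicity v.asIdeal I := by
  have hf : FiniteMultiplicity v.asIdeal I := FiniteMultiplicity.of_prime_left v.prime hI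
  obtain ⟨n, hn⟩ := Int.eq_ofNat_of_zero_le (FractionalIdeal.count_coe_nonneg K v I)
  rw [hn, Nat.cast_inj]
  refine eq_of_forall_le_iff fun k ↦ ?_
  rw [← hf.pow_dvd_iff_le_multiplicity, Ideal.dvd_iff_le, ← natCast_le_count_coe_iff K v hI, hn,
    Nat.cast_le]

theorem count_map (P : HeightOneSpectrum (𝓞 L)) (p : HeightOneSpectrum (𝓞 M))
    [P.asIdeal.LiesOver p.asIdeal] {I : Ideal (𝓞 M)} (hI : I ≠ ⊥) :
    FractionalIdeal.count L P (I.map (algebraMap (𝓞 M) (𝓞 L)) : FractionalIdeal (𝓞 L)⁰ L) =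
      P.asIdeal.ramificationIdx (𝓞 M) * FractionalIdeal.count M p (I : FractionalIdeal (𝓞 M)⁰ M) := by
  have h := Ideal.IsDedekindDomain.emultiplicity_map_eq_ramificationIdx'_mul (S := 𝓞 L) hI
    p.irreducible P.irreducible P.ne_bot
  have hI' : I.map (algebraMap (𝓞 M) (𝓞 L)) ≠ ⊥ := Ideal.map_ne_bot_of_ne_bot hI
  rw [Ideal.ramificationIdx'_eq_ramificationIdx _ _ p.ne_bot,
    (FiniteMultiplicity.of_prime_left P.prime hI').emultiplicity_eq_multiplicity,
    (FiniteMultiplicity.of_prime_left p.prime hI).emultiplicity_eq_multiplicity] at h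
  rw [count_coe_eq_multiplicity L P hI', count_coe_eq_multiplicity M p hI]
  exact_mod_cast h

theorem count_extendedHom (P : HeightOneSpectrum (𝓞 L)) (p : HeightOneSpectrum (𝓞 M))
    [P.asIdeal.LiesOver p.asIdeal] (C : FractionalIdeal (𝓞 M)⁰ M) :
    FractionalIdeal.count L P (C.extendedHom L (𝓞 L)) =
      P.asIdeal.ramificationIdx (𝓞 M) * FractionalIdeal.count M p C := by
  by_cases hC : C = 0
  · rw [hC, map_zero, FractionalIdeal.count_zero, FractionalIdeal.count_zero, mul_zero]
  obtain ⟨a, J, ha, hJ⟩ := FractionalIdeal.exists_eq_spanSingleton_mul C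
  have hJ0 : J ≠ ⊥ := by
    rintro rfl
    exact hC (by simpa using hJ)
  have ha' : Ideal.span {a} ≠ ⊥ := by simpa using ha
  have haF : (Ideal.span {a} : FractionalIdeal (𝓞 M)⁰ M) ≠ 0 :=
    FractionalIdeal.coeIdeal_ne_zero.mpr ha'
  have hC2 : C * (Ideal.span {a} : FractionalIdeal (𝓞 M)⁰ M) = J := by
    rw [hJ, FractionalIdeal.coeIdeal_span_singleton, mul_right_comm,
      FractionalIdeal.spanSingleton_mul_spanSingleton, inv_mul_cancel₀ (by simpa using ha),
      FractionalIdeal.spanSingleton_one, one_mul]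
  have h1 := congrArg (FractionalIdeal.count M p) hC2
  have h2 := congrArg (fun X ↦ FractionalIdeal.count L P (FractionalIdeal.extendedHom L (𝓞 L) X)) hC2
  simp only [map_mul] at h2
  rw [FractionalIdeal.count_mul M p hC haF] at h1
  rw [FractionalIdeal.count_mul L P (mt (FractionalIdeal.extendedHom_eq_zero_iff L (𝓞 L)).mp hC)
    (mt (FractionalIdeal.extendedHom_eq_zero_iff L (𝓞 L)).mp haF),
    FractionalIdeal.extendedHom_coeIdeal_eq_map, FractionalIdeal.extendedHom_coeIdeal_eq_map,
    count_map P p hJ0, count_map P p ha', ← h1] at h2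
  linarith

variable (M) in
/-- The trace of a fractional ideal. -/
noncomputable def traceIdeal (A : FractionalIdeal (𝓞 L)⁰ L) : FractionalIdeal (𝓞 M)⁰ M :=
  ⟨((A : Submodule (𝓞 L) L).restrictScalars (𝓞 M)).map
      ((Algebra.trace M L).restrictScalars (𝓞 M)), by
    refine FractionalIdeal.isFractional_of_fg ?_
    refine Submodule.FG.map _ ?_
    exact Submodule.FG.restrictScalars (FractionalIdeal.fg_of_isNoetherianRing le_rfl A)⟩

theorem mem_traceIdeal {A : FractionalIdeal (𝓞 L)⁰ L} {c : M} :
    c ∈ traceIdeal M A ↔ ∃ α ∈ A, Algebra.trace M L α = c :=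
  Iff.rfl

theorem traceIdeal_ne_zero {A : FractionalIdeal (𝓞 L)⁰ L} (hA : A ≠ 0) : traceIdeal M A ≠ 0 := by
  obtain ⟨α, hα, hα0⟩ : ∃ α ∈ A, α ≠ 0 := by
    by_contra! h
    exact hA ((FractionalIdeal.eq_zero_iff).mpr h)
  obtain ⟨x, hx⟩ : ∃ x, Algebra.trace M L (α * x) ≠ 0 := by
    by_contra! h
    exact hα0 ((traceForm_nondegenerate M L).1 α h)
  obtain ⟨n, hn, hy⟩ := ((IsFractionRing.isAlgebraic_iff ℤ ℚ L).mpr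
    (Algebra.IsAlgebraic.isAlgebraic x)).exists_integral_multiple
  intro h
  have h1 : Algebra.trace M L (((⟨n • x, hy⟩ : 𝓞 L)) • α) ∈ traceIdeal M A :=
    mem_traceIdeal.mpr ⟨_, (A : Submodule (𝓞 L) L).smul_mem _ hα, rfl⟩
  rw [h, FractionalIdeal.mem_zero_iff, Algebra.smul_def] at h1
  change Algebra.trace M L (n • x * α) = 0 at h1
  rw [smul_mul_assoc, map_zsmul, mul_comm, smul_eq_zero] at h1
  exact h1.elim hn hx

/-- If `Tr(x) y` is integral for all `x ∈ X` and `y ∈ Y`, then `X Y` is in the inverse different. -/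
theorem mul_extendedHom_le_inverseDifferent {X : FractionalIdeal (𝓞 L)⁰ L}
    {Y : FractionalIdeal (𝓞 M)⁰ M}
    (h : ∀ x ∈ X, ∀ y ∈ Y, ∃ t : 𝓞 M, (t : M) = y * Algebra.trace M L x) :
    X * Y.extendedHom L (𝓞 L) ≤ inverseDifferent M L := by
  rw [FractionalIdeal.mul_le]
  intro x hx y hy
  have hy' : y ∈ (Y.extendedHom L (𝓞 L) : Submodule (𝓞 L) L) := hy
  rw [FractionalIdeal.coe_extendedHom_eq_span] at hy'
  induction hy' using Submodule.span_induction with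
  | mem z hz =>
    obtain ⟨d, hd, rfl⟩ := hz
    rw [mem_inverseDifferent_iff]
    intro a
    obtain ⟨t, ht⟩ := h (a • x) (Submodule.smul_mem _ _ hx) d hd
    refine ⟨t, ht.trans ?_⟩
    rw [← smul_eq_mul, ← map_smul, Algebra.smul_def, Algebra.smul_def]
    congr 1
    change _ * ((a : L) * x) = _
    ring
  | zero => rw [mul_zero]; exact Submodule.zero_mem _
  | add a b ha hb iha ihb =>
    rw [mul_add]
    rw [← FractionalIdeal.coe_extendedHom_eq_span] at ha hb
    exact Submodule.add_mem _ (iha ha) (ihb hb)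
  | smul r z hz ih =>
    rw [← FractionalIdeal.coe_extendedHom_eq_span] at hz
    rw [mul_smul_comm]
    exact Submodule.smul_mem _ _ (ih hz)

end Count

/-! ### Nonvanishing of trace sums modulo a prime. -/

section Trace

variable {K L : Type*} [Field K] [NumberField K] [Field L] [NumberField L] [Algebra K L]

theorem apply_mem_inverseDifferent (σ : Gal(L/K)) {x : L} (hx : x ∈ inverseDifferent K L) :
    σ x ∈ inverseDifferent K L := by
  rw [mem_inverseDifferent_iff] at hx ⊢
  intro a
  obtain ⟨t, ht⟩ := hx (σ⁻¹ • a)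
  refine ⟨t, ht.trans ?_⟩
  rw [← Algebra.trace_eq_of_algEquiv σ (x * _), map_mul]
  congr 2
  change σ (σ⁻¹ (a : L)) = a
  exact σ.apply_symm_apply _

theorem apply_mem_of_sq_eq {A : FractionalIdeal (𝓞 L)⁰ L} (hA : A ^ 2 = inverseDifferent K L)
    (σ : Gal(L/K)) {x : L} (hx : x ∈ A) : σ x ∈ A := by
  refine mem_of_sq_mem_sq ?_
  rw [hA, ← map_pow]
  refine apply_mem_inverseDifferent σ ?_
  rw [← hA, sq, sq]
  exact FractionalIdeal.mul_mem_mul hx hx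

theorem exists_trace_mul_eq {A : FractionalIdeal (𝓞 L)⁰ L} (hA : A ^ 2 = inverseDifferent K L)
    {x y : L} (hx : x ∈ A) (hy : y ∈ A) : ∃ t : 𝓞 K, (t : K) = Algebra.trace K L (x * y) := by
  have h : x * y ∈ inverseDifferent K L := by
    rw [← hA, sq]
    exact FractionalIdeal.mul_mem_mul hx hy
  simpa using mem_inverseDifferent_iff.mp h 1

theorem exists_coe_eq_mul_of_mem_differentIdeal {u : 𝓞 L} (hu : u ∈ differentIdeal (𝓞 K) (𝓞 L))
    {a : L} (ha : a ∈ inverseDifferent K L) : ∃ e : 𝓞 L, (e : L) = u * a := by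
  have h1 : (u : L) * a ∈ (1 : FractionalIdeal (𝓞 L)⁰ L) := by
    have h2 : (differentIdeal (𝓞 K) (𝓞 L) : FractionalIdeal (𝓞 L)⁰ L) *
        inverseDifferent K L = 1 :=
      mul_inv_cancel₀ (FractionalIdeal.coeIdeal_ne_zero.mpr differentIdeal_ne_bot)
    rw [← h2]
    exact FractionalIdeal.mul_mem_mul (FractionalIdeal.mem_coeIdeal_of_mem _ hu) ha
  exact (FractionalIdeal.mem_one_iff _).mp h1

/-- The fibre of restriction over `g` is a coset `σ₀ Gal(L/M)`. -/
theorem sum_apply_filter_restrictNormalHom_eq [IsGalois K L] (M : IntermediateField K L)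
    [IsGalois K M] (g : Gal(M/K))
    [DecidablePred fun σ : Gal(L/K) ↦ AlgEquiv.restrictNormalHom M σ = g] (γ : L) :
    ∑ σ : Gal(L/K) with AlgEquiv.restrictNormalHom M σ = g, σ γ =
      algebraMap M L (g (Algebra.trace M L γ)) := by
  obtain ⟨σ₀, rfl⟩ := AlgEquiv.restrictNormalHom_surjective (K₁ := M) (E := L) g
  have hc : algebraMap M L (AlgEquiv.restrictNormalHom M σ₀ (Algebra.trace M L γ)) =
      σ₀ (algebraMap M L (Algebra.trace M L γ)) :=
    AlgEquiv.restrictNormal_commutes σ₀ M _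
  rw [hc, trace_eq_sum_automorphisms, map_sum]
  symm
  refine Finset.sum_bij (fun τ _ ↦ σ₀ * AlgEquiv.restrictScalars K τ) (fun τ _ ↦ ?_)
    (fun τ _ τ' _ h ↦ ?_) (fun σ hσ ↦ ?_) (fun τ _ ↦ rfl)
  · have : AlgEquiv.restrictScalars K τ ∈ M.fixingSubgroup :=
      (IntermediateField.mem_fixingSubgroup_iff _ _).mpr fun x hx ↦ τ.commutes ⟨x, hx⟩
    rw [← IntermediateField.restrictNormalHom_ker, MonoidHom.mem_ker] at this
    simp [this]
  · exact AlgEquiv.restrictScalars_injective K (mul_left_cancel h)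
  · have h1 : σ₀⁻¹ * σ ∈ M.fixingSubgroup := by
      rw [← IntermediateField.restrictNormalHom_ker, MonoidHom.mem_ker, map_mul,
        (Finset.mem_filter.mp hσ).2, map_inv, inv_mul_cancel]
    refine ⟨AlgEquiv.ofRingEquiv (f := (σ₀⁻¹ * σ : Gal(L/K)).toRingEquiv) fun x ↦
      (IntermediateField.mem_fixingSubgroup_iff _ _).mp h1 x x.2, Finset.mem_univ _, ?_⟩
    have : AlgEquiv.restrictScalars K (AlgEquiv.ofRingEquiv
      (f := (σ₀⁻¹ * σ : Gal(L/K)).toRingEquiv) fun x : M ↦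
      (IntermediateField.mem_fixingSubgroup_iff _ _).mp h1 x x.2) = σ₀⁻¹ * σ := rfl
    rw [this, mul_inv_cancel_left]

/-- Descends the vanishing `hV` from `L` to `M`. With a dual basis `a i`, `b i` of `M/K`, apply `hV`
to the pairs `u a_i α'`, `b_i α` and add. As `χ` factors through `Gal(M/K)`, the terms can be
grouped by `g`. The `g`-th group is `Tr(u c' g(c) ∑ a_i g(b_i))`, which vanishes unless `g = 1`. The
factor `u` from the different makes `u a_i` integral. -/
theorem exists_mem_ker_eq_trace [IsGalois K L] (M : IntermediateField K L) [IsGalois K M]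
    {A : FractionalIdeal (𝓞 L)⁰ L} (hA : A ^ 2 = inverseDifferent K L) {F : Type*} [Field F]
    (θ : 𝓞 K →+* F) (χ : Gal(L/K) →* F)
    (hχ : ∀ σ ∈ M.fixingSubgroup, χ σ = 1)
    (hV : ∀ α ∈ A, ∀ β ∈ A, ∀ T : Gal(L/K) → 𝓞 K,
      (∀ σ, (T σ : K) = Algebra.trace K L (α * σ β)) → ∑ σ, θ (T σ) * χ σ = 0)
    {c c' : M} (hc : c ∈ traceIdeal M A) (hc' : c' ∈ traceIdeal M A) {u : 𝓞 M}
    (hu : u ∈ differentIdeal (𝓞 K) (𝓞 M)) :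
    ∃ t ∈ RingHom.ker θ, (t : K) = Algebra.trace K M (c * c' * u) := by
  classical
  obtain ⟨α, hα, rfl⟩ := mem_traceIdeal.mp hc
  obtain ⟨α', hα', rfl⟩ := mem_traceIdeal.mp hc'
  obtain ⟨n, a, b, ha, hab⟩ := exists_finset_sum_trace_mul_eq K M
  have he (i : Fin n) := exists_coe_eq_mul_of_mem_differentIdeal hu (ha i)
  choose e he using he
  set δ : Fin n → L := fun i ↦ algebraMap (𝓞 M) (𝓞 L) (e i) • α' with hδ
  set γ : Fin n → L := fun i ↦ algebraMap (𝓞 M) (𝓞 L) (b i) • α with hγ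
  have hδA (i) : δ i ∈ A := Submodule.smul_mem _ _ hα'
  have hγA (i) : γ i ∈ A := Submodule.smul_mem _ _ hα
  have hδt (i) : Algebra.trace M L (δ i) = e i * Algebra.trace M L α' := by
    rw [← smul_eq_mul, ← map_smul, Algebra.smul_def]; rfl
  have hγt (i) : Algebra.trace M L (γ i) = b i * Algebra.trace M L α := by
    rw [← smul_eq_mul, ← map_smul, Algebra.smul_def]; rfl
  choose T hT using fun (i : Fin n) (σ : Gal(L/K)) ↦
    exists_trace_mul_eq hA (hδA i) (apply_mem_of_sq_eq hA σ (hγA i))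
  have h0 : ∑ i, ∑ σ, θ (T i σ) * χ σ = 0 :=
    Finset.sum_eq_zero fun i _ ↦ hV _ (hδA i) _ (hγA i) (T i) (hT i)
  let S (g : Gal(M/K)) : 𝓞 K :=
    ∑ σ : Gal(L/K) with AlgEquiv.restrictNormalHom M σ = g, ∑ i, T i σ
  have hS (g : Gal(M/K)) : (S g : K) = if g = 1 then
      Algebra.trace K M (Algebra.trace M L α * Algebra.trace M L α' * u) else 0 := by
    have h1 : (S g : K) = ∑ i, Algebra.trace K L (δ i *
        ∑ σ : Gal(L/K) with AlgEquiv.restrictNormalHom M σ = g, σ (γ i)) := by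
      simp only [S, map_sum, hT, Finset.mul_sum]
      exact Finset.sum_comm
    have h2 (i) : Algebra.trace K L (δ i *
        ∑ σ : Gal(L/K) with AlgEquiv.restrictNormalHom M σ = g, σ (γ i)) =
        Algebra.trace K M ((u * Algebra.trace M L α' * g (Algebra.trace M L α)) *
          (a i * g (b i))) := by
      rw [sum_apply_filter_restrictNormalHom_eq, ← Algebra.trace_trace (S := M), mul_comm (δ i),
        ← Algebra.smul_def, map_smul, hδt, hγt, he, map_mul, smul_eq_mul]
      congr 1
      ring
    rw [h1, Finset.sum_congr rfl fun i _ ↦ h2 i, ← map_sum, ← Finset.mul_sum,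
      sum_mul_apply_eq_ite hab]
    split_ifs with hg
    · subst hg
      congr 1
      simp only [AlgEquiv.one_apply]
      ring
    · rw [mul_zero, map_zero]
  choose s hs using AlgEquiv.restrictNormalHom_surjective (F := K) (K₁ := M) (E := L)
  have hχs (σ : Gal(L/K)) : χ σ = χ (s (AlgEquiv.restrictNormalHom M σ)) := by
    have h1 : (s (AlgEquiv.restrictNormalHom M σ))⁻¹ * σ ∈ M.fixingSubgroup := by
      rw [← IntermediateField.restrictNormalHom_ker, MonoidHom.mem_ker, map_mul, map_inv, hs,
        inv_mul_cancel]
    have h2 := hχ _ h1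
    conv_lhs => rw [← mul_inv_cancel_left (s (AlgEquiv.restrictNormalHom M σ)) σ, map_mul, h2,
      mul_one]
  have h3 : ∑ i, ∑ σ, θ (T i σ) * χ σ = ∑ g : Gal(M/K), θ (S g) * χ (s g) := by
    rw [Finset.sum_comm, ← Finset.sum_fiberwise (g := AlgEquiv.restrictNormalHom M)]
    refine Finset.sum_congr rfl fun g _ ↦ ?_
    rw [map_sum, Finset.sum_mul]
    refine Finset.sum_congr rfl fun σ hσ ↦ ?_
    rw [map_sum, Finset.sum_mul, hχs σ, (Finset.mem_filter.mp hσ).2]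
  rw [h3, Finset.sum_eq_single 1] at h0
  · have h4 : χ (s 1) = 1 := by
      refine hχ _ ?_
      rw [← IntermediateField.restrictNormalHom_ker, MonoidHom.mem_ker, hs]
    rw [h4, mul_one] at h0
    exact ⟨S 1, h0, by rw [hS, if_pos rfl]⟩
  · intro g _ hg
    have : S g = 0 := RingOfIntegers.ext (by rw [hS, if_neg hg]; rfl)
    rw [this, map_zero, zero_mul]
  · exact fun h ↦ absurd (Finset.mem_univ _) h

/-- If all sums vanish, the valuation `c` at `𝔭` of `C = Tr_{L/M}(A)`, with `M` the fixed field of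
`W`, is bounded in two incompatible ways. Write `q = |W|`, and let `m = 2k + 1` be the odd
ramification index of `𝔭` over `K`. Then Hilbert's formula gives `A` the valuation `1 - q(k + 1)`.
-/
theorem exists_trace_sum_ne_zero [IsGalois K L] (hcomm : ∀ σ τ : Gal(L/K), σ * τ = τ * σ)
    (hodd : Odd (Nat.card Gal(L/K)))
    (hw : ∀ P : HeightOneSpectrum (𝓞 L), (P.asIdeal ^ 3).inertia Gal(L/K) = ⊥)
    {A : FractionalIdeal (𝓞 L)⁰ L} (hA : A ^ 2 = inverseDifferent K L) {F : Type*} [Field F]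
    (θ : 𝓞 K →+* F) (hθ : RingHom.ker θ ≠ ⊥) (χ : Gal(L/K) →* F) :
    ∃ α ∈ A, ∃ β ∈ A, ∃ T : Gal(L/K) → 𝓞 K,
      (∀ σ, (T σ : K) = Algebra.trace K L (α * σ β)) ∧ ∑ σ, θ (T σ) * χ σ ≠ 0 := by
  by_contra! hV
  have hA0 : A ≠ 0 := by
    rintro rfl
    exact inverseDifferent_ne_zero K L (by rw [← hA, zero_pow two_ne_zero])
  let v : HeightOneSpectrum (𝓞 K) := ⟨RingHom.ker θ, RingHom.ker_isPrime θ, hθ⟩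
  have := v.isPrime
  obtain ⟨⟨P₀, hP₀, hPv⟩⟩ := v.asIdeal.nonempty_primesOver (S := 𝓞 L)
  let P : HeightOneSpectrum (𝓞 L) := ⟨P₀, hP₀, Ideal.ne_bot_of_liesOver_of_ne_bot v.ne_bot P₀⟩
  have : P.asIdeal.LiesOver v.asIdeal := hPv
  set W := (P.asIdeal ^ 2).inertia Gal(L/K) with hW
  have hWn : W.Normal := ⟨fun n hn g ↦ by rwa [hcomm g n, mul_inv_cancel_right]⟩
  obtain ⟨p, hpF⟩ := CharP.exists F
  have hpv : (p : 𝓞 K) ∈ v.asIdeal := by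
    change (p : 𝓞 K) ∈ RingHom.ker θ
    rw [RingHom.mem_ker, map_natCast, CharP.cast_eq_zero]
  have hp : p.Prime := by
    refine (CharP.char_is_prime_or_zero F p).resolve_right ?_
    have h1 : (Ideal.absNorm v.asIdeal : F) = 0 := by
      have : (Ideal.absNorm v.asIdeal : 𝓞 K) ∈ RingHom.ker θ := Ideal.absNorm_mem v.asIdeal
      rwa [RingHom.mem_ker, map_natCast] at this
    rw [CharP.cast_eq_zero_iff F p] at h1
    rintro rfl
    exact v.ne_bot (Ideal.absNorm_eq_zero_iff.mp (zero_dvd_iff.mp h1))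
  have hpP : (p : 𝓞 L) ∈ P.asIdeal := by
    rwa [(Ideal.LiesOver.over : v.asIdeal = P.asIdeal.under (𝓞 K)), Ideal.mem_comap,
      map_natCast] at hpv
  -- `χ w` is a `p`-th root of unity in a field of characteristic `p`.
  have hχ (w : Gal(L/K)) (hwW : w ∈ W) : χ w = 1 := by
    have : Fact p.Prime := ⟨hp⟩
    have h1 : χ w ^ p = 1 := by
      rw [← map_pow, pow_eq_one_of_mem_inertia_sq (hw P) hwW hpP, map_one]
    exact frobenius_inj F p (by simpa [frobenius_def] using h1)
  let M : IntermediateField K L := IntermediateField.fixedField W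
  have : IsGalois K M := IsGalois.of_fixedField_normal_subgroup W
  have hgal : IsGaloisGroup W (𝓞 M) (𝓞 L) :=
    inferInstanceAs (IsGaloisGroup W (𝓞 (FixedPoints.intermediateField W)) (𝓞 L))
  have hfix : M.fixingSubgroup = W := IntermediateField.fixingSubgroup_fixedField W
  let 𝔭 : HeightOneSpectrum (𝓞 M) :=
    ⟨P.asIdeal.under (𝓞 M), inferInstance, mt Ideal.eq_bot_of_comap_eq_bot P.ne_bot⟩
  have : P.asIdeal.LiesOver 𝔭.asIdeal := ⟨rfl⟩
  have : 𝔭.asIdeal.LiesOver v.asIdeal := Ideal.LiesOver.tower_bot P.asIdeal 𝔭.asIdeal v.asIdeal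
  have hWle : W ≤ P.asIdeal.inertia Gal(L/K) := fun σ hσ x ↦ Ideal.pow_le_self two_ne_zero (hσ x)
  have hW1 : P.asIdeal.inertia W = ⊤ := eq_top_iff.mpr fun σ _ ↦ Ideal.coe_mem_inertia.mp (hWle σ.2)
  have hW2 : (P.asIdeal ^ 2).inertia W = ⊤ := eq_top_iff.mpr fun σ _ ↦ Ideal.coe_mem_inertia.mp σ.2
  have hW3 : (P.asIdeal ^ 3).inertia W = ⊥ := by
    have : (P.asIdeal ^ 3).inertia W = ((P.asIdeal ^ 3).inertia Gal(L/K)).subgroupOf W := rfl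
    rw [this, hw P, Subgroup.bot_subgroupOf]
  have e1 : P.asIdeal.ramificationIdx (𝓞 M) = Nat.card W := by
    rw [ramificationIdx_eq_card_inertia (E := M) (G := W) P.asIdeal P.ne_bot, hW1, Subgroup.card_top]
  have e2 := Ideal.ramificationIdx_tower (R := 𝓞 K) 𝔭.asIdeal P.asIdeal
  rw [e1, ramificationIdx_eq_card_inertia (E := K) (G := Gal(L/K)) P.asIdeal P.ne_bot] at e2
  have d1 := count_differentIdeal_of_inertia_eq_top M P hW1 hW3
  rw [hW2, Subgroup.card_top] at d1
  have d2 := count_differentIdeal P (hw P)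
  have hD1 : differentIdeal (𝓞 M) (𝓞 L) ≠ ⊥ := differentIdeal_ne_bot
  have hD0 : differentIdeal (𝓞 K) (𝓞 M) ≠ ⊥ := differentIdeal_ne_bot
  have hDF0 := (FractionalIdeal.coeIdeal_ne_zero (K := M)).mpr hD0
  have hD2 : (differentIdeal (𝓞 K) (𝓞 M)).map (algebraMap (𝓞 M) (𝓞 L)) ≠ ⊥ :=
    Ideal.map_ne_bot_of_ne_bot hD0
  have d3 := congrArg (FractionalIdeal.count L P) hA
  rw [FractionalIdeal.count_pow, inverseDifferent, FractionalIdeal.count_inv, d2] at d3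
  rw [differentIdeal_eq_differentIdeal_mul_differentIdeal (𝓞 K) (𝓞 M) (𝓞 L),
    FractionalIdeal.coeIdeal_mul, FractionalIdeal.count_mul L P
    (FractionalIdeal.coeIdeal_ne_zero.mpr hD1) (FractionalIdeal.coeIdeal_ne_zero.mpr hD2), d1,
    count_map P 𝔭 hD0, e1] at d2
  set C := traceIdeal M A with hC
  have hC0 : C ≠ 0 := traceIdeal_ne_zero hA0
  -- The trace of `A C⁻¹` is integral, which bounds `c` above: `q c ≤ q(1 - k) - 1`.
  have v1 : A * (C⁻¹).extendedHom L (𝓞 L) ≤ inverseDifferent M L := by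
    refine mul_extendedHom_le_inverseDifferent fun x hx y hy ↦ ?_
    exact (FractionalIdeal.mem_one_iff _).mp
      ((FractionalIdeal.mem_inv_iff hC0).mp hy _ (mem_traceIdeal.mpr ⟨x, hx, rfl⟩))
  -- The assumed vanishing says `Tr(C² D) ⊆ v`, which bounds `c` below.
  have v2 : C * C * (differentIdeal (𝓞 K) (𝓞 M) : FractionalIdeal (𝓞 M)⁰ M) *
      ((v.asIdeal : FractionalIdeal (𝓞 K)⁰ K)⁻¹).extendedHom M (𝓞 M) ≤ inverseDifferent K M := by
    refine mul_extendedHom_le_inverseDifferent fun x hx y hy ↦ ?_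
    have hv0 : (v.asIdeal : FractionalIdeal (𝓞 K)⁰ K) ≠ 0 :=
      FractionalIdeal.coeIdeal_ne_zero.mpr v.ne_bot
    refine (FractionalIdeal.mem_one_iff _).mp ((FractionalIdeal.mem_inv_iff hv0).mp hy _ ?_)
    refine FractionalIdeal.mul_induction_on hx (fun i hi y hy ↦ ?_) fun x y hx hy ↦ ?_
    · obtain ⟨u, hu, rfl⟩ := (FractionalIdeal.mem_coeIdeal _).mp hy
      refine FractionalIdeal.mul_induction_on hi (fun c hc c' hc' ↦ ?_) fun x y hx hy ↦ ?_
      · obtain ⟨t, ht, ht'⟩ := exists_mem_ker_eq_trace M hA θ χ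
          (fun σ hσ ↦ hχ σ (hfix ▸ hσ)) hV hc hc' hu
        exact (FractionalIdeal.mem_coeIdeal _).mpr ⟨t, ht, ht'⟩
      · rw [add_mul, map_add]
        exact Submodule.add_mem _ hx hy
    · rw [map_add]
      exact Submodule.add_mem _ hx hy
  have hCi : (C⁻¹).extendedHom L (𝓞 L) ≠ 0 :=
    mt (FractionalIdeal.extendedHom_eq_zero_iff L (𝓞 L)).mp (inv_ne_zero hC0)
  have hvi : ((v.asIdeal : FractionalIdeal (𝓞 K)⁰ K)⁻¹).extendedHom M (𝓞 M) ≠ 0 :=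
    mt (FractionalIdeal.extendedHom_eq_zero_iff M (𝓞 M)).mp
      (inv_ne_zero (FractionalIdeal.coeIdeal_ne_zero.mpr v.ne_bot))
  have c1 := FractionalIdeal.count_mono L P (mul_ne_zero hA0 hCi) v1
  have c2 := FractionalIdeal.count_mono M 𝔭
    (mul_ne_zero (mul_ne_zero (mul_ne_zero hC0 hC0) hDF0) hvi) v2
  rw [FractionalIdeal.count_mul L P hA0 hCi, count_extendedHom P 𝔭, e1, FractionalIdeal.count_inv,
    inverseDifferent, FractionalIdeal.count_inv, d1] at c1
  rw [FractionalIdeal.count_mul M 𝔭 (mul_ne_zero (mul_ne_zero hC0 hC0) hDF0) hvi,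
    FractionalIdeal.count_mul M 𝔭 (mul_ne_zero hC0 hC0) hDF0,
    FractionalIdeal.count_mul M 𝔭 hC0 hC0, count_extendedHom 𝔭 v, FractionalIdeal.count_inv,
    FractionalIdeal.count_self, inverseDifferent, FractionalIdeal.count_inv] at c2
  have hq : 0 < (Nat.card W : ℤ) := by exact_mod_cast Nat.card_pos
  have hm : Odd (𝔭.asIdeal.ramificationIdx (𝓞 K)) := by
    have : Odd (Nat.card (P.asIdeal.inertia Gal(L/K))) :=
      hodd.of_dvd_nat (Subgroup.card_subgroup_dvd_card _)
    rw [e2] at this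
    exact (Nat.odd_mul.mp this).1
  rw [e2] at d2 d3
  obtain ⟨k, hk⟩ := hm
  rw [hk] at c2 d2 d3
  push_cast at c1 c2 d2 d3
  generalize (Nat.card W : ℤ) = q at *
  generalize FractionalIdeal.count M 𝔭 C = c at *
  generalize FractionalIdeal.count L P A = a at *
  generalize FractionalIdeal.count M 𝔭 (differentIdeal (𝓞 K) (𝓞 M) : FractionalIdeal (𝓞 M)⁰ M) = d
    at *
  -- Transitivity of the different: `q d = (qm + q - 2) - 2(q - 1)`, so `d = m - 1`, the tame value.
  have hd : d = 2 * k := by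
    have : q * (d - 2 * k) = 0 := by linarith
    linarith [(mul_eq_zero.mp this).resolve_left hq.ne']
  subst hd
  -- The lower bound reads `2c ≥ 1 - 2k`; oddness of `m` lets it be rounded up.
  have h5 : (1 : ℤ) - k ≤ c := by omega
  have h6 := mul_le_mul_of_nonneg_left h5 hq.le
  linarith

end Trace

/-! ### The field `K^h` and its Galois group inside `G`. -/

section FieldOf

variable {K : Type*} [Field K] [NumberField K]
  {G : Type*} [CommGroup G] [TopologicalSpace G] [DiscreteTopology G]

theorem fixingSubgroup_fieldOf (h : GaloisHom K G) :
    (fieldOf h).fixingSubgroup = h.toMonoidHom.ker := by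
  have hopen : IsOpen (h.toMonoidHom.ker : Set Gal(AlgebraicClosure K/K)) := by
    have : (h.toMonoidHom.ker : Set Gal(AlgebraicClosure K/K)) = h ⁻¹' {1} := by
      ext x
      simp [MonoidHom.mem_ker]
    rw [this]
    exact (isOpen_discrete _).preimage h.continuous_toFun
  exact InfiniteGalois.fixingSubgroup_fixedField (k := K) (K := AlgebraicClosure K)
    ⟨h.toMonoidHom.ker, Subgroup.isClosed_of_isOpen _ hopen⟩

instance (h : GaloisHom K G) : IsGalois K (fieldOf h) :=
  IsGalois.of_fixedField_normal_subgroup h.toMonoidHom.ker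

theorem mem_fieldOf_iff {h : GaloisHom K G} {y : AlgebraicClosure K} :
    y ∈ fieldOf h ↔ ∀ ω, h ω = 1 → ω y = y :=
  ⟨fun hy ω hω ↦ hy ⟨ω, hω⟩, fun hy ω ↦ hy ω.1 ω.2⟩

theorem restrictNormalHom_eq_one_iff {h : GaloisHom K G} {ω : Gal(AlgebraicClosure K/K)} :
    AlgEquiv.restrictNormalHom (fieldOf h) ω = 1 ↔ h ω = 1 := by
  rw [← MonoidHom.mem_ker, IntermediateField.restrictNormalHom_ker, fixingSubgroup_fieldOf]
  rfl

theorem restrictNormalHom_fieldOf_surjective (h : GaloisHom K G) : Function.Surjective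
    (AlgEquiv.restrictNormalHom (F := K) (K₁ := AlgebraicClosure K) (fieldOf h)) :=
  AlgEquiv.restrictNormalHom_surjective (F := K) (K₁ := fieldOf h) (E := AlgebraicClosure K)

theorem coe_restrictNormalHom_apply (h : GaloisHom K G) (ω : Gal(AlgebraicClosure K/K))
    (a : fieldOf h) : (AlgEquiv.restrictNormalHom (fieldOf h) ω a : AlgebraicClosure K) = ω a :=
  AlgEquiv.restrictNormal_commutes ω (fieldOf h) a

/-- The injection `Gal(K^h/K) → G` induced by `h`. -/
noncomputable def galHom (h : GaloisHom K G) : Gal(fieldOf h/K) →* G :=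
  MonoidHom.liftOfSurjective (AlgEquiv.restrictNormalHom (F := K) (K₁ := AlgebraicClosure K)
    (fieldOf h)) (restrictNormalHom_fieldOf_surjective h)
    ⟨h.toMonoidHom, fun _ hω ↦ restrictNormalHom_eq_one_iff.mp hω⟩

@[simp]
theorem galHom_restrictNormalHom (h : GaloisHom K G) (ω : Gal(AlgebraicClosure K/K)) :
    galHom h (AlgEquiv.restrictNormalHom (fieldOf h) ω) = h ω :=
  MonoidHom.liftOfRightInverse_comp_apply _ _ _ _ ω

theorem galHom_injective (h : GaloisHom K G) : Function.Injective (galHom h) := by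
  rw [injective_iff_map_eq_one]
  intro σ hσ
  obtain ⟨ω, rfl⟩ := restrictNormalHom_fieldOf_surjective h σ
  rw [galHom_restrictNormalHom] at hσ
  exact restrictNormalHom_eq_one_iff.mpr hσ

theorem fieldOf_mul_comm (h : GaloisHom K G) (σ τ : Gal(fieldOf h/K)) : σ * τ = τ * σ :=
  galHom_injective h (by rw [map_mul, map_mul, mul_comm])

theorem odd_card_gal [Finite G] (hG : Odd (Nat.card G)) (h : GaloisHom K G) :
    Odd (Nat.card Gal(fieldOf h/K)) := by
  refine hG.of_dvd_nat ?_
  rw [Nat.card_congr (MonoidHom.ofInjective (galHom_injective h)).toEquiv]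
  exact Subgroup.card_subgroup_dvd_card _

theorem IsWeaklyRamified.inertia_eq_bot {h : GaloisHom K G} (hw : IsWeaklyRamified h)
    (P : HeightOneSpectrum (𝓞 (fieldOf h))) : (P.asIdeal ^ 3).inertia Gal(fieldOf h/K) = ⊥ :=
  hw P.asIdeal P.isPrime P.ne_bot

theorem galoisHom_inv_apply (h : GaloisHom K G) (ω : Gal(AlgebraicClosure K/K)) :
    h⁻¹ ω = (h ω)⁻¹ := rfl

theorem galoisHom_mul_apply (h h' : GaloisHom K G) (ω : Gal(AlgebraicClosure K/K)) :
    (h * h') ω = h ω * h' ω := rfl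

theorem fieldOf_inv (h : GaloisHom K G) : fieldOf h⁻¹ = fieldOf h := by
  ext y
  simp [mem_fieldOf_iff, galoisHom_inv_apply]

theorem exists_algebraMap_eq_of_forall_apply_eq {y : AlgebraicClosure K}
    (hy : ∀ ω : Gal(AlgebraicClosure K/K), ω y = y) : ∃ k : K, algebraMap K _ k = y :=
  IntermediateField.mem_bot.mp ((InfiniteGalois.mem_bot_iff_fixed y).mpr hy)

/-- A function `f` on `G` that is equivariant and has values in the inverse different has an
integral sum. -/
theorem exists_eq_sum_of_mem_inverseDifferent [Fintype G] {h : GaloisHom K G}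
    {f : G → AlgebraicClosure K} (hf : ∀ ω t, f ((h ω)⁻¹ * t) = ω (f t))
    (hfD : ∀ t, ∃ y ∈ inverseDifferent K (fieldOf h), (y : AlgebraicClosure K) = f t) :
    ∃ r : 𝓞 K, algebraMap (𝓞 K) (AlgebraicClosure K) r = ∑ t, f t := by
  classical
  choose y hyD hy using hfD
  have hy1 (t : G) : ∃ r : 𝓞 K, (r : K) = Algebra.trace K (fieldOf h) (y t) := by
    simpa using mem_inverseDifferent_iff.mp (hyD t) 1
  choose r hr using hy1
  -- By equivariance, the values of `f` on one coset of the image of `h` are the conjugates of a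
  -- single value, so each coset contributes a trace.
  refine ⟨∑ q : G ⧸ (galHom h).range, r q.out, ?_⟩
  rw [map_sum, ← Finset.sum_fiberwise (s := Finset.univ) (g := fun t : G ↦ (t : G ⧸ (galHom h).range))]
  refine Finset.sum_congr rfl fun q _ ↦ ?_
  rw [IsScalarTower.algebraMap_apply (𝓞 K) K, show algebraMap (𝓞 K) K (r q.out) = _ from hr _,
    IsScalarTower.algebraMap_apply K (fieldOf h), trace_eq_sum_automorphisms, map_sum]
  refine Finset.sum_bij (fun σ _ ↦ (galHom h σ)⁻¹ * q.out) (fun σ _ ↦ ?_) (fun σ _ τ _ e ↦ ?_)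
    (fun t ht ↦ ?_) (fun σ _ ↦ ?_)
  · rw [Finset.mem_filter_univ]
    conv_rhs => rw [← q.out_eq']
    rw [eq_comm, QuotientGroup.eq]
    exact ⟨σ⁻¹, by simp [mul_comm]⟩
  · exact galHom_injective h (inv_injective (mul_right_cancel e))
  · rw [Finset.mem_filter_univ, ← q.out_eq', eq_comm, QuotientGroup.eq] at ht
    obtain ⟨σ, hσ⟩ := ht
    exact ⟨σ⁻¹, Finset.mem_univ _, by rw [map_inv, inv_inv, hσ, mul_comm, mul_inv_cancel_left]⟩
  · obtain ⟨ω, rfl⟩ := restrictNormalHom_fieldOf_surjective h σ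
    rw [galHom_restrictNormalHom, hf, ← hy]
    exact coe_restrictNormalHom_apply h ω _

end FieldOf

/-! ### Equivariant lattices in `K^c[G]`. -/

section Lattice

/-- The group algebra `K^c[G]`. -/
abbrev ClosureGroupRing (K : Type*) [Field K] (G : Type*) [CommGroup G] : Type _ :=
  MonoidAlgebra (AlgebraicClosure K) G

noncomputable instance {K : Type*} [Field K] [NumberField K] {G : Type*} [CommGroup G] :
    Algebra (GroupRing K G) (ClosureGroupRing K G) :=
  MonoidAlgebra.algebraMonoidAlgebra

variable {K : Type*} [Field K] [NumberField K]
  {G : Type*} [CommGroup G] [TopologicalSpace G] [DiscreteTopology G] [Fintype G]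

theorem coeff_algebraMap (r : GroupRing K G) (t : G) :
    (algebraMap (GroupRing K G) (ClosureGroupRing K G) r).coeff t =
      algebraMap (𝓞 K) (AlgebraicClosure K) (r.coeff t) := by
  change (MonoidAlgebra.mapRingHom G (algebraMap (𝓞 K) (AlgebraicClosure K)) r).coeff t = _
  simp

theorem coeff_mul_eq_sum {S : Type*} [Semiring S] (x y : MonoidAlgebra S G) (t : G) :
    (x * y).coeff t = ∑ s, x.coeff s * y.coeff (s⁻¹ * t) := by
  rw [MonoidAlgebra.coeff_mul_apply_left, Finsupp.sum_fintype]
  simp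

theorem coeff_smul_eq_sum (r : GroupRing K G) (x : ClosureGroupRing K G) (t : G) :
    (r • x).coeff t = ∑ s, algebraMap (𝓞 K) (AlgebraicClosure K) (r.coeff s) * x.coeff (s⁻¹ * t) := by
  simp only [Algebra.smul_def, coeff_mul_eq_sum, coeff_algebraMap]

instance : FaithfulSMul (GroupRing K G) (ClosureGroupRing K G) := by
  rw [faithfulSMul_iff_algebraMap_injective]
  intro r r' h
  ext t
  have := congrArg (fun z ↦ z.coeff t) h
  simp only [coeff_algebraMap] at this
  exact (algebraMap K (AlgebraicClosure K)).injective this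

theorem algebraMap_mul_mem (N : Submodule (𝓞 K) (AlgebraicClosure K)) (r : 𝓞 K)
    {y : AlgebraicClosure K} (hy : y ∈ N) : algebraMap (𝓞 K) (AlgebraicClosure K) r * y ∈ N := by
  have := N.smul_mem r hy
  rwa [Algebra.smul_def] at this

theorem apply_algebraMap (ω : Gal(AlgebraicClosure K/K)) (r : 𝓞 K) :
    ω (algebraMap (𝓞 K) (AlgebraicClosure K) r) = algebraMap (𝓞 K) (AlgebraicClosure K) r :=
  ω.commutes (r : K)

/-- The `𝓞_K G`-lattice in `K^c[G]` of elements `∑ a(t) t⁻¹`, where `a ∈ K_h` has values in `N`. -/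
def lattice (h : GaloisHom K G) (N : Submodule (𝓞 K) (AlgebraicClosure K)) :
    Submodule (GroupRing K G) (ClosureGroupRing K G) where
  carrier := {x | (∀ (ω : Gal(AlgebraicClosure K/K)) (t : G),
    x.coeff ((h ω)⁻¹ * t) = ω (x.coeff t)) ∧ ∀ t, x.coeff t ∈ N}
  add_mem' := by
    rintro x y ⟨hx, hx'⟩ ⟨hy, hy'⟩
    exact ⟨fun ω t ↦ by simp [hx, hy], fun t ↦ by simpa using add_mem (hx' t) (hy' t)⟩
  zero_mem' := ⟨fun ω t ↦ by simp, fun t ↦ by simp⟩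
  smul_mem' := by
    rintro r x ⟨hx, hx'⟩
    refine ⟨fun ω t ↦ ?_, fun t ↦ ?_⟩
    · rw [coeff_smul_eq_sum, coeff_smul_eq_sum, map_sum]
      refine Finset.sum_congr rfl fun s _ ↦ ?_
      rw [mul_left_comm, hx, map_mul ω, apply_algebraMap]
    · rw [coeff_smul_eq_sum]
      exact sum_mem fun s _ ↦ algebraMap_mul_mem N _ (hx' _)

theorem mem_fieldOf_of_mem_lattice {h : GaloisHom K G} {N : Submodule (𝓞 K) (AlgebraicClosure K)}
    {x : ClosureGroupRing K G} (hx : x ∈ lattice h N) (t : G) : x.coeff t ∈ fieldOf h :=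
  mem_fieldOf_iff.mpr fun ω hω ↦ by rw [← hx.1 ω t, hω, inv_one, one_mul]

theorem mem_one_iff {x : ClosureGroupRing K G} :
    x ∈ (1 : Submodule (GroupRing K G) (ClosureGroupRing K G)) ↔
      ∀ t, ∃ r : 𝓞 K, algebraMap (𝓞 K) (AlgebraicClosure K) r = x.coeff t := by
  rw [Submodule.mem_one]
  refine ⟨?_, fun H ↦ ?_⟩
  · rintro ⟨r, rfl⟩ t
    exact ⟨r.coeff t, (coeff_algebraMap r t).symm⟩
  · choose r hr using H
    refine ⟨.ofCoeff (Finsupp.equivFunOnFinite.symm r), ?_⟩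
    ext t
    rw [coeff_algebraMap, ← hr]
    rfl

theorem coeff_mul_equivariant {h h' : GaloisHom K G} {x y : ClosureGroupRing K G}
    (hx : ∀ (ω : Gal(AlgebraicClosure K/K)) (t : G), x.coeff ((h ω)⁻¹ * t) = ω (x.coeff t))
    (hy : ∀ (ω : Gal(AlgebraicClosure K/K)) (t : G), y.coeff ((h' ω)⁻¹ * t) = ω (y.coeff t))
    (ω : Gal(AlgebraicClosure K/K)) (t : G) :
    (x * y).coeff (((h * h') ω)⁻¹ * t) = ω ((x * y).coeff t) := by
  rw [coeff_mul_eq_sum, coeff_mul_eq_sum, map_sum, ← Equiv.sum_comp (Equiv.mulLeft (h ω)⁻¹)]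
  refine Finset.sum_congr rfl fun s _ ↦ ?_
  rw [map_mul ω, ← hx, ← hy, galoisHom_mul_apply, Equiv.coe_mulLeft]
  congr 2
  simp only [mul_inv, inv_inv]
  rw [mul_mul_mul_comm, mul_inv_cancel_left]

theorem lattice_mul_le {h h' : GaloisHom K G} {N N' N'' : Submodule (𝓞 K) (AlgebraicClosure K)}
    (hN : ∀ a ∈ N, ∀ b ∈ N', a * b ∈ N'') :
    lattice h N * lattice h' N' ≤ lattice (h * h') N'' := by
  rw [Submodule.mul_le]
  intro x hx y hy
  refine ⟨coeff_mul_equivariant hx.1 hy.1, fun t ↦ ?_⟩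
  rw [coeff_mul_eq_sum]
  exact sum_mem fun s _ ↦ hN _ (hx.2 _) _ (hy.2 _)

variable (K G) in
/-- The automorphism of `K^c[G]` that inverts group elements. -/
noncomputable def antipode : ClosureGroupRing K G ≃ₐ[AlgebraicClosure K] ClosureGroupRing K G :=
  MonoidAlgebra.domCongr (AlgebraicClosure K) (AlgebraicClosure K) (MulEquiv.inv G)

@[simp]
theorem coeff_antipode (x : ClosureGroupRing K G) (t : G) :
    (antipode K G x).coeff t = x.coeff t⁻¹ := by
  rw [antipode, MonoidAlgebra.coeff_domCongr]
  rfl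

theorem antipode_mem_lattice {h : GaloisHom K G} {N : Submodule (𝓞 K) (AlgebraicClosure K)}
    {x : ClosureGroupRing K G} (hx : x ∈ lattice h N) : antipode K G x ∈ lattice h⁻¹ N := by
  refine ⟨fun ω t ↦ ?_, fun t ↦ ?_⟩
  · rw [coeff_antipode, coeff_antipode, ← hx.1, galoisHom_inv_apply, inv_inv, mul_inv]
  · rw [coeff_antipode]
    exact hx.2 _

open Classical in
/-- The element of `K_h` that has the value `a` at `1` and vanishes outside of the image of `h`. -/
noncomputable def ofField (h : GaloisHom K G) (a : fieldOf h) : ClosureGroupRing K G :=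
  ∑ σ : Gal(fieldOf h/K), MonoidAlgebra.single (galHom h σ)⁻¹ (σ a : AlgebraicClosure K)

open Classical in
theorem coeff_ofField (h : GaloisHom K G) (a : fieldOf h) (t : G) :
    (ofField h a).coeff t =
      ∑ σ : Gal(fieldOf h/K), if (galHom h σ)⁻¹ = t then (σ a : AlgebraicClosure K) else 0 := by
  simp [ofField, Finsupp.single_apply, MonoidAlgebra.coeff_sum]

theorem ofField_mem_lattice (h : GaloisHom K G) {a : fieldOf h}
    {N : Submodule (𝓞 K) (AlgebraicClosure K)} (ha : ∀ σ : Gal(fieldOf h/K), (σ a : AlgebraicClosure K) ∈ N) :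
    ofField h a ∈ lattice h N := by
  classical
  refine ⟨fun ω t ↦ ?_, fun t ↦ ?_⟩
  · rw [coeff_ofField, coeff_ofField, map_sum,
      ← Equiv.sum_comp (Equiv.mulLeft (AlgEquiv.restrictNormalHom (fieldOf h) ω))]
    refine Finset.sum_congr rfl fun σ _ ↦ ?_
    rw [Equiv.coe_mulLeft, map_mul, galHom_restrictNormalHom, mul_inv, mul_right_inj, apply_ite ω,
      map_zero, AlgEquiv.mul_apply, coe_restrictNormalHom_apply]
  · rw [coeff_ofField]
    refine sum_mem fun σ _ ↦ ?_
    split_ifs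
    exacts [ha σ, N.zero_mem]

/-- The link between multiplication in `K^c[G]` and the trace form: the coefficient at `h(σ)`
collects the products `τ(a) τσ(b)` over all `τ`. -/
theorem ofField_mul_antipode_ofField (h : GaloisHom K G) (a b : fieldOf h) :
    ofField h a * antipode K G (ofField h b) = ∑ σ : Gal(fieldOf h/K),
      MonoidAlgebra.single (galHom h σ) (algebraMap K (AlgebraicClosure K)
        (Algebra.trace K (fieldOf h) (a * σ b))) := by
  classical
  have h1 : antipode K G (ofField h b) = ∑ σ : Gal(fieldOf h/K),
      MonoidAlgebra.single (galHom h σ) (σ b : AlgebraicClosure K) := by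
    rw [ofField, map_sum]
    refine Finset.sum_congr rfl fun σ _ ↦ ?_
    simp [antipode]
  rw [h1, ofField, Finset.sum_mul]
  have h2 (σ : Gal(fieldOf h/K)) : algebraMap K (AlgebraicClosure K)
      (Algebra.trace K (fieldOf h) (a * σ b)) =
      ∑ τ : Gal(fieldOf h/K), (τ a : AlgebraicClosure K) * (τ * σ) b := by
    rw [IsScalarTower.algebraMap_apply K (fieldOf h), trace_eq_sum_automorphisms, map_sum]
    refine Finset.sum_congr rfl fun τ _ ↦ ?_
    rw [map_mul, map_mul]
    rfl
  simp_rw [h2]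
  have h3 (g : G) (f : Gal(fieldOf h/K) → AlgebraicClosure K) :
      MonoidAlgebra.single g (∑ τ, f τ) = ∑ τ, MonoidAlgebra.single g (f τ) :=
    map_sum (MonoidAlgebra.singleAddHom g) f Finset.univ
  simp_rw [h3]
  rw [Finset.sum_comm]
  refine Finset.sum_congr rfl fun τ _ ↦ ?_
  rw [Finset.mul_sum, ← Equiv.sum_comp (Equiv.mulLeft τ)]
  refine Finset.sum_congr rfl fun σ _ ↦ ?_
  rw [MonoidAlgebra.single_mul_single, Equiv.coe_mulLeft, map_mul, inv_mul_cancel_left]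

end Lattice

/-! ### Invertible modules are locally free. -/

section LocallyFree

theorem finite_maximalSpectrum_of_finite (R S : Type*) [CommRing R] [IsLocalRing R] [CommRing S]
    [Algebra R S] [Module.Finite R S] : Finite (MaximalSpectrum S) := by
  have := (Algebra.QuasiFinite.finite_primesOver (S := S) (IsLocalRing.maximalIdeal R)).to_subtype
  refine Finite.of_injective
    (fun M : MaximalSpectrum S ↦ (⟨M.asIdeal, M.isMaximal.isPrime, ⟨?_⟩⟩ :
      (IsLocalRing.maximalIdeal R).primesOver S)) fun M N h ↦ ?_
  · have := M.isMaximal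
    exact (IsLocalRing.eq_maximalIdeal (Ideal.isMaximal_comap_of_isIntegral_of_isMaximal
      M.asIdeal)).symm
  · exact MaximalSpectrum.ext (congrArg Subtype.val h)

variable {K : Type*} [Field K] [NumberField K] {G : Type*} [CommGroup G] [Finite G]

instance (v : HeightOneSpectrum (𝓞 K)) : Finite (MaximalSpectrum (LocalGroupRing G v)) :=
  finite_maximalSpectrum_of_finite (v.adicCompletionIntegers K) _

/-- The local group rings are semilocal, so their Picard groups are trivial and the local conditions
are automatic. -/
theorem mem_locallyFreeClassGroup (c : CommRing.Pic (GroupRing K G)) :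
    c ∈ LocallyFreeClassGroup K G :=
  Subgroup.mem_iInf.mpr fun _ ↦ Subsingleton.elim _ _

theorem isLocallyFree_of_invertible (M : Type*) [AddCommGroup M] [Module (GroupRing K G) M]
    [Module.Invertible (GroupRing K G) M] : IsLocallyFree K G M := by
  refine ⟨inferInstance, fun v ↦ ?_⟩
  let := (toLocal G v).toAlgebra
  exact Module.Invertible.free_iff_linearEquiv.mp inferInstance

theorem isClassOf_cl {M : Type*} [AddCommGroup M] [Module (GroupRing K G) M]
    {c : LocallyFreeClassGroup K G} (h : IsClassOf c M) : IsClassOf (cl K G M) M := by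
  have : ∃ c : LocallyFreeClassGroup K G, IsClassOf c M := ⟨c, h⟩
  rw [cl, dif_pos this]
  exact this.choose_spec

theorem IsClassOf.unique {M : Type*} [AddCommGroup M] [Module (GroupRing K G) M]
    {c c' : LocallyFreeClassGroup K G} (h : IsClassOf c M) (h' : IsClassOf c' M) : c = c' :=
  Subtype.ext (CommRing.Pic.ext_iff.mpr ⟨h.some.symm.trans h'.some⟩)

end LocallyFree

/-! ### Invertibility of `A_h`, its class, and inverses. -/

section SqrtIdeal

theorem algebraMap_single {K : Type*} [Field K] [NumberField K] {G : Type*} [CommGroup G] (g : G)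
    (r : 𝓞 K) : algebraMap (GroupRing K G) (ClosureGroupRing K G) (MonoidAlgebra.single g r) =
      MonoidAlgebra.single g (algebraMap (𝓞 K) (AlgebraicClosure K) r) := by
  change MonoidAlgebra.mapRingHom G (algebraMap (𝓞 K) (AlgebraicClosure K)) _ = _
  simp

variable {K : Type*} [Field K] [NumberField K]

/-- The square root of the inverse different of `L/K` as a subset of the algebraic closure. -/
noncomputable def sqrtValues (L : IntermediateField K (AlgebraicClosure K)) [NumberField L] :
    Submodule (𝓞 K) (AlgebraicClosure K) where
  carrier := {y | ∃ a ∈ sqrtInverseDifferent K L, (a : AlgebraicClosure K) = y}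
  add_mem' := by
    rintro _ _ ⟨a, ha, rfl⟩ ⟨b, hb, rfl⟩
    exact ⟨a + b, Submodule.add_mem _ ha hb, rfl⟩
  zero_mem' := ⟨0, Submodule.zero_mem _, rfl⟩
  smul_mem' := by
    rintro r _ ⟨a, ha, rfl⟩
    refine ⟨algebraMap (𝓞 K) (𝓞 L) r • a, Submodule.smul_mem _ _ ha, ?_⟩
    simp only [Algebra.smul_def]
    rfl

theorem sqrtValues_congr {L L' : IntermediateField K (AlgebraicClosure K)} [hL : NumberField L]
    [hL' : NumberField L'] (e : L = L') : sqrtValues L = sqrtValues L' := by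
  subst e
  rfl

variable {G : Type*} [CommGroup G] [TopologicalSpace G] [DiscreteTopology G] [Fintype G]

/-- `A_h` as a lattice in `K^c[G]`. -/
noncomputable def sqrtIdeal (h : GaloisHom K G) :
    Submodule (GroupRing K G) (ClosureGroupRing K G) :=
  lattice h (sqrtValues (fieldOf h))

theorem antipode_mem_sqrtIdeal {h : GaloisHom K G} {x : ClosureGroupRing K G}
    (hx : x ∈ sqrtIdeal h) : antipode K G x ∈ sqrtIdeal h⁻¹ := by
  rw [sqrtIdeal, sqrtValues_congr (fieldOf_inv h)]
  exact antipode_mem_lattice hx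

theorem sqrtInverseDifferent_sq_of_isWeaklyRamified (hG : Odd (Nat.card G)) {h : GaloisHom K G}
    (hw : IsWeaklyRamified h) :
    sqrtInverseDifferent K (fieldOf h) ^ 2 = inverseDifferent K (fieldOf h) :=
  sqrtInverseDifferent_sq (odd_card_gal hG h) hw.inertia_eq_bot

/-- A coefficient of the product is a sum over `G` of an equivariant function with values in `A² =
D⁻¹`, hence a sum of integral traces. -/
theorem sqrtIdeal_mul_sqrtIdeal_inv_le {h : GaloisHom K G}
    (hA : sqrtInverseDifferent K (fieldOf h) ^ 2 = inverseDifferent K (fieldOf h)) :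
    sqrtIdeal h * sqrtIdeal h⁻¹ ≤ 1 := by
  rw [Submodule.mul_le]
  intro x hx y hy
  rw [mem_one_iff]
  intro t
  rw [coeff_mul_eq_sum]
  refine exists_eq_sum_of_mem_inverseDifferent (h := h) (fun ω s ↦ ?_) fun s ↦ ?_
  · rw [map_mul ω, ← hx.1, ← hy.1, galoisHom_inv_apply, inv_inv, mul_inv, inv_inv, mul_assoc]
  · obtain ⟨a, ha, hax⟩ := hx.2 s
    rw [sqrtIdeal, sqrtValues_congr (fieldOf_inv h)] at hy
    obtain ⟨b, hb, hby⟩ := hy.2 (s⁻¹ * t)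
    refine ⟨a * b, ?_, ?_⟩
    · rw [← hA, sq]
      exact FractionalIdeal.mul_mem_mul ha hb
    · rw [← hax, ← hby]
      rfl

/-- `F` is integral over `𝓞_K`; an injection of `𝓞_K` into it would make `𝓞_K` a field. -/
theorem ker_ne_bot_of_field {F : Type*} [Field F] (f : GroupRing K G →+* F)
    (hf : Function.Surjective f) :
    RingHom.ker (f.comp (algebraMap (𝓞 K) (GroupRing K G))) ≠ ⊥ := by
  intro hker
  have hinj := (RingHom.injective_iff_ker_eq_bot _).mpr hker
  algebraize [f, f.comp (algebraMap (𝓞 K) (GroupRing K G))]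
  have hs : IsScalarTower (𝓞 K) (GroupRing K G) F := IsScalarTower.of_algebraMap_eq fun _ ↦ rfl
  have : Algebra.IsIntegral (𝓞 K) F := Algebra.IsIntegral.of_surjective
    (IsScalarTower.toAlgHom (𝓞 K) (GroupRing K G) F) hf
  exact RingOfIntegers.not_isField K (isField_of_isIntegral_of_isField hinj (Field.toIsField F))

/-- A proper product lies in a maximal ideal `m`. Reduction modulo `m` restricts to `θ` on `𝓞_K`
and, through `h`, to a character `χ` of the Galois group, for which some trace sum is nonzero. -/
theorem one_le_sqrtIdeal_mul_sqrtIdeal_inv (hG : Odd (Nat.card G)) {h : GaloisHom K G}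
    (hw : IsWeaklyRamified h) : 1 ≤ sqrtIdeal h * sqrtIdeal h⁻¹ := by
  let I : Ideal (GroupRing K G) := (sqrtIdeal h * sqrtIdeal h⁻¹).comap
    (Algebra.linearMap (GroupRing K G) (ClosureGroupRing K G))
  suffices hI : I = ⊤ by
    rw [Submodule.one_le]
    have : (1 : GroupRing K G) ∈ I := hI ▸ Submodule.mem_top
    simpa [I] using this
  by_contra hI
  obtain ⟨m, hm, hIm⟩ := Ideal.exists_le_maximal I hI
  let := Ideal.Quotient.field m
  have hA := sqrtInverseDifferent_sq_of_isWeaklyRamified hG hw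
  obtain ⟨α, hα, β, hβ, T, hT, hne⟩ := exists_trace_sum_ne_zero (fieldOf_mul_comm h)
    (odd_card_gal hG h) hw.inertia_eq_bot hA
    ((Ideal.Quotient.mk m).comp (algebraMap (𝓞 K) (GroupRing K G)))
    (ker_ne_bot_of_field _ Ideal.Quotient.mk_surjective)
    ((Ideal.Quotient.mk m : GroupRing K G →* GroupRing K G ⧸ m).comp
      ((MonoidAlgebra.of (𝓞 K) G).comp (galHom h)))
  refine hne ?_
  have h1 : ofField h α * antipode K G (ofField h β) ∈ sqrtIdeal h * sqrtIdeal h⁻¹ := by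
    refine Submodule.mul_mem_mul ?_ (antipode_mem_sqrtIdeal ?_)
    · exact ofField_mem_lattice h fun σ ↦ ⟨_, apply_mem_of_sq_eq hA σ hα, rfl⟩
    · exact ofField_mem_lattice h fun σ ↦ ⟨_, apply_mem_of_sq_eq hA σ hβ, rfl⟩
  -- `r` lies in the product, hence in `m`, yet its residue is the nonzero trace sum.
  let r : GroupRing K G := ∑ σ, MonoidAlgebra.single (galHom h σ) (T σ)
  have h2 : algebraMap (GroupRing K G) (ClosureGroupRing K G) r =
      ofField h α * antipode K G (ofField h β) := by
    rw [ofField_mul_antipode_ofField, map_sum]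
    refine Finset.sum_congr rfl fun σ _ ↦ ?_
    rw [← hT]
    exact algebraMap_single _ _
  have h3 : r ∈ m := hIm (Submodule.mem_comap.mpr (by rwa [Algebra.linearMap_apply, h2]))
  rw [← Ideal.Quotient.eq_zero_iff_mem, map_sum] at h3
  rw [← h3]
  refine Finset.sum_congr rfl fun σ _ ↦ ?_
  change Ideal.Quotient.mk m (algebraMap (𝓞 K) (GroupRing K G) (T σ)) *
    Ideal.Quotient.mk m (MonoidAlgebra.of (𝓞 K) G (galHom h σ)) = _
  rw [← map_mul]
  congr 1
  simp

/-- `A_h` as an invertible `𝓞_K G`-lattice in `K^c[G]`. -/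
noncomputable def sqrtUnit (hG : Odd (Nat.card G)) {h : GaloisHom K G}
    (hw : IsWeaklyRamified h) : (Submodule (GroupRing K G) (ClosureGroupRing K G))ˣ where
  val := sqrtIdeal h
  inv := sqrtIdeal h⁻¹
  val_inv := le_antisymm
    (sqrtIdeal_mul_sqrtIdeal_inv_le (sqrtInverseDifferent_sq_of_isWeaklyRamified hG hw))
    (one_le_sqrtIdeal_mul_sqrtIdeal_inv hG hw)
  inv_val := by
    rw [mul_comm]
    exact le_antisymm
      (sqrtIdeal_mul_sqrtIdeal_inv_le (sqrtInverseDifferent_sq_of_isWeaklyRamified hG hw))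
      (one_le_sqrtIdeal_mul_sqrtIdeal_inv hG hw)

/-- The identification of `A_h` with a lattice in `K^c[G]`. -/
noncomputable def sqrtModuleEquiv (h : GaloisHom K G) :
    SqrtModule h ≃ₗ[GroupRing K G] sqrtIdeal h := by
  -- The inversion in `t⁻¹` turns the action `(s • a)(t) = a(ts)` into multiplication by `s`.
  let e : SqrtModule h ≃+ sqrtIdeal h :=
    { toFun a := ⟨.ofCoeff (Finsupp.equivFunOnFinite.symm fun t ↦
          ((sqrtRep h).asModuleEquiv a).1 t⁻¹), fun ω t ↦ by
        have := ((sqrtRep h).asModuleEquiv a).2.1 ω t⁻¹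
        simpa [mul_comm] using this, fun t ↦ ((sqrtRep h).asModuleEquiv a).2.2 t⁻¹⟩
      invFun x := (sqrtRep h).asModuleEquiv.symm ⟨fun t ↦ x.1.coeff t⁻¹, fun ω t ↦ by
        have := x.2.1 ω t⁻¹
        simpa [mul_comm] using this, fun t ↦ x.2.2 t⁻¹⟩
      left_inv a := by
        refine (sqrtRep h).asModuleEquiv.injective (Subtype.ext (funext fun t ↦ ?_))
        simp
      right_inv x := by
        refine Subtype.ext ?_
        ext t
        simp
      map_add' a b := by
        refine Subtype.ext ?_
        ext t
        simp }
  refine e.toLinearEquiv fun r a ↦ ?_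
  induction r using MonoidAlgebra.induction_linear with
  | zero => rw [zero_smul, zero_smul, map_zero]
  | add r r' hr hr' => rw [add_smul, add_smul, map_add, hr, hr']
  | single g c =>
    refine Subtype.ext ?_
    ext t
    rw [Submodule.coe_smul, Algebra.smul_def, algebraMap_single,
      MonoidAlgebra.coeff_single_mul_apply, Representation.single_smul]
    change (c • ((sqrtRep h).asModuleEquiv a).1) (t⁻¹ * g) =
      _ * ((sqrtRep h).asModuleEquiv a).1 (g⁻¹ * t)⁻¹
    rw [mul_inv, inv_inv, mul_comm g]
    exact Algebra.smul_def c (((sqrtRep h).asModuleEquiv a).1 (t⁻¹ * g))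

/-- The class of the lattice `A_h`. -/
noncomputable def sqrtClass (hG : Odd (Nat.card G)) {h : GaloisHom K G}
    (hw : IsWeaklyRamified h) : LocallyFreeClassGroup K G :=
  ⟨Submodule.unitsToPic _ _ (sqrtUnit hG hw), mem_locallyFreeClassGroup _⟩

theorem isClassOf_sqrtClass (hG : Odd (Nat.card G)) {h : GaloisHom K G}
    (hw : IsWeaklyRamified h) : IsClassOf (sqrtClass hG hw) (SqrtModule h) :=
  ⟨(sqrtModuleEquiv h).trans (Submodule.unitsToPicEquiv (sqrtUnit hG hw)).symm⟩

theorem galA_eq_sqrtClass (hG : Odd (Nat.card G)) {h : GaloisHom K G}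
    (hw : IsWeaklyRamified h) : galA h = sqrtClass hG hw :=
  (isClassOf_cl (isClassOf_sqrtClass hG hw)).unique (isClassOf_sqrtClass hG hw)

theorem isLocallyFree_sqrtModule (hG : Odd (Nat.card G)) {h : GaloisHom K G}
    (hw : IsWeaklyRamified h) : IsLocallyFree K G (SqrtModule h) := by
  have : Module.Invertible (GroupRing K G) (SqrtModule h) :=
    .congr ((isClassOf_sqrtClass hG hw).some.symm)
  exact isLocallyFree_of_invertible _

theorem ramificationGroup_eq_bot_congr {L L' : IntermediateField K (AlgebraicClosure K)}
    (e : L = L') (n : ℕ)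
    (h : ∀ P : Ideal (𝓞 L), P.IsPrime → P ≠ ⊥ → ramificationGroup K P n = ⊥) :
    ∀ P : Ideal (𝓞 L'), P.IsPrime → P ≠ ⊥ → ramificationGroup K P n = ⊥ := by
  subst e
  exact h

theorem IsWeaklyRamified.inv {h : GaloisHom K G} (hw : IsWeaklyRamified h) :
    IsWeaklyRamified h⁻¹ :=
  ramificationGroup_eq_bot_congr (fieldOf_inv h).symm 2 hw

theorem galA_inv (hG : Odd (Nat.card G)) {h : GaloisHom K G} (hw : IsWeaklyRamified h) :
    galA h⁻¹ = (galA h)⁻¹ := by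
  rw [galA_eq_sqrtClass hG hw, galA_eq_sqrtClass hG hw.inv]
  have : sqrtUnit hG hw.inv = (sqrtUnit hG hw)⁻¹ := Units.ext rfl
  refine Subtype.ext ?_
  simp only [sqrtClass, this, map_inv]
  rfl

end SqrtIdeal

/-! ### Ramification groups in a compositum. -/

section Compositum

variable {K L N : Type*} [Field K] [NumberField K] [Field L] [NumberField L] [Field N] [NumberField N]
  [Algebra K L] [Algebra K N] [Algebra L N] [IsScalarTower K L N]

theorem algebraMap_restrictNormalHom_smul [IsGalois K L] (σ : Gal(N/K)) (x : 𝓞 L) :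
    algebraMap (𝓞 L) (𝓞 N) (AlgEquiv.restrictNormalHom L σ • x) = σ • algebraMap (𝓞 L) (𝓞 N) x :=
  RingOfIntegers.ext (AlgEquiv.restrictNormal_commutes σ L (x : L))

theorem restrictNormalHom_mem_inertia [IsGalois K L] {I : Ideal (𝓞 N)} {σ : Gal(N/K)}
    (hσ : σ ∈ I.inertia Gal(N/K)) :
    AlgEquiv.restrictNormalHom L σ ∈ (I.under (𝓞 L)).inertia Gal(L/K) := by
  intro x
  change algebraMap (𝓞 L) (𝓞 N) _ ∈ I
  rw [map_sub, algebraMap_restrictNormalHom_smul]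
  exact hσ _

theorem under_pow_of_ramificationIdx_eq_one (P : HeightOneSpectrum (𝓞 N))
    (p : HeightOneSpectrum (𝓞 L)) [P.asIdeal.LiesOver p.asIdeal]
    (he : P.asIdeal.ramificationIdx (𝓞 L) = 1) (n : ℕ) :
    (P.asIdeal ^ n).under (𝓞 L) = p.asIdeal ^ n := by
  ext x
  rw [Ideal.mem_comap]
  by_cases hx : x = 0
  · simp [hx]
  have h0 : Ideal.span {x} ≠ ⊥ := by simpa using hx
  have h1 : (Ideal.span {x}).map (algebraMap (𝓞 L) (𝓞 N)) ≠ ⊥ := Ideal.map_ne_bot_of_ne_bot h0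
  have h2 := count_map P p h0
  rw [he, Nat.cast_one, one_mul] at h2
  have h3 := natCast_le_count_coe_iff N P h1 n
  rw [h2, natCast_le_count_coe_iff L p h0, Ideal.map_span, Set.image_singleton,
    Ideal.span_singleton_le_iff_mem, Ideal.span_singleton_le_iff_mem] at h3
  exact h3.symm

variable {L₁ : Type*} [Field L₁] [NumberField L₁] [Algebra K L₁] [Algebra L₁ N]
  [IsScalarTower K L₁ N] [IsGalois K N] [IsGalois K L₁] [IsGalois K L]

/-- Inertia at `P` restricts into the inertia group of `L₁`, which is trivial since `L₁` is
unramified there. -/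
theorem injective_restrictNormalHom_inertia
    (hinj : ∀ σ : Gal(N/K), AlgEquiv.restrictNormalHom L₁ σ = 1 →
      AlgEquiv.restrictNormalHom L σ = 1 → σ = 1)
    (P : HeightOneSpectrum (𝓞 N)) (he : (P.asIdeal.under (𝓞 L₁)).ramificationIdx (𝓞 K) = 1)
    {σ : Gal(N/K)} (hσ : σ ∈ P.asIdeal.inertia Gal(N/K))
    (hσL : AlgEquiv.restrictNormalHom L σ = 1) : σ = 1 := by
  refine hinj σ ?_ hσL
  rw [ramificationIdx_eq_card_inertia (G := Gal(L₁/K)) _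
    (mt Ideal.eq_bot_of_comap_eq_bot P.ne_bot), Subgroup.card_eq_one] at he
  rw [← Subgroup.mem_bot, ← he]
  exact restrictNormalHom_mem_inertia hσ

/-- Restriction embeds the inertia group of `N` in that of `L`, while `e(N/K) = e(L/K) e(N/L)` gives
the opposite inequality of orders. -/
theorem bijective_restrictNormalHom_inertia
    (hinj : ∀ σ : Gal(N/K), AlgEquiv.restrictNormalHom L₁ σ = 1 →
      AlgEquiv.restrictNormalHom L σ = 1 → σ = 1)
    (P : HeightOneSpectrum (𝓞 N)) (he : (P.asIdeal.under (𝓞 L₁)).ramificationIdx (𝓞 K) = 1) :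
    P.asIdeal.ramificationIdx (𝓞 L) = 1 ∧ ∀ τ ∈ (P.asIdeal.under (𝓞 L)).inertia Gal(L/K),
      ∃ σ ∈ P.asIdeal.inertia Gal(N/K), AlgEquiv.restrictNormalHom L σ = τ := by
  let f : P.asIdeal.inertia Gal(N/K) →* (P.asIdeal.under (𝓞 L)).inertia Gal(L/K) :=
    ((AlgEquiv.restrictNormalHom L).comp (Subgroup.subtype _)).codRestrict _
      fun σ ↦ restrictNormalHom_mem_inertia σ.2
  have hf : Function.Injective f := by
    rw [injective_iff_map_eq_one]
    exact fun σ hσ ↦ Subtype.ext (injective_restrictNormalHom_inertia (L₁ := L₁) hinj P he σ.2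
      (congrArg Subtype.val hσ))
  have h1 := Nat.card_le_card_of_injective f hf
  have h2 := Ideal.ramificationIdx_tower (R := 𝓞 K) (P.asIdeal.under (𝓞 L)) P.asIdeal
  rw [ramificationIdx_eq_card_inertia (G := Gal(N/K)) _ P.ne_bot,
    ramificationIdx_eq_card_inertia (G := Gal(L/K)) _
      (mt Ideal.eq_bot_of_comap_eq_bot P.ne_bot)] at h2
  have h3 : 0 < Nat.card (P.asIdeal.inertia Gal(N/K)) := Nat.card_pos
  have h4 : 0 < Nat.card ((P.asIdeal.under (𝓞 L)).inertia Gal(L/K)) := Nat.card_pos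
  have h5 : P.asIdeal.ramificationIdx (𝓞 L) = 1 := by
    refine le_antisymm ?_ (Nat.pos_of_ne_zero fun h ↦ ?_)
    · rw [h2] at h1
      exact Nat.le_of_mul_le_mul_left (by simpa using h1) h4
    · rw [h, mul_zero] at h2
      omega
  rw [h5, mul_one] at h2
  have hs : Function.Surjective f :=
    ((Nat.bijective_iff_injective_and_card f).mpr ⟨hf, h2⟩).2
  refine ⟨h5, fun τ hτ ↦ ?_⟩
  obtain ⟨σ, hσ⟩ := hs ⟨τ, hτ⟩
  exact ⟨σ, σ.2, congrArg Subtype.val hσ⟩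

/-- The second ramification group does not change in a compositum with a field that is
unramified at the given prime. -/
theorem inertia_pow_three_eq_bot_iff
    (hinj : ∀ σ : Gal(N/K), AlgEquiv.restrictNormalHom L₁ σ = 1 →
      AlgEquiv.restrictNormalHom L σ = 1 → σ = 1)
    (P : HeightOneSpectrum (𝓞 N)) (he : (P.asIdeal.under (𝓞 L₁)).ramificationIdx (𝓞 K) = 1) :
    (P.asIdeal ^ 3).inertia Gal(N/K) = ⊥ ↔
      ((P.asIdeal.under (𝓞 L)) ^ 3).inertia Gal(L/K) = ⊥ := by
  obtain ⟨he', hlift⟩ := bijective_restrictNormalHom_inertia (L := L) hinj P he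
  let p : HeightOneSpectrum (𝓞 L) :=
    ⟨P.asIdeal.under (𝓞 L), inferInstance, mt Ideal.eq_bot_of_comap_eq_bot P.ne_bot⟩
  have : P.asIdeal.LiesOver p.asIdeal := ⟨rfl⟩
  have hpow (n : ℕ) : (P.asIdeal ^ n).under (𝓞 L) = P.asIdeal.under (𝓞 L) ^ n :=
    under_pow_of_ramificationIdx_eq_one P p he' n
  refine ⟨fun h ↦ ?_, fun h ↦ ?_⟩
  · rw [eq_bot_iff]
    intro τ hτ
    obtain ⟨σ, hσ, rfl⟩ := hlift τ fun x ↦ Ideal.pow_le_self three_ne_zero (hτ x)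
    let I := P.asIdeal.inertia Gal(N/K)
    let E := (FixedPoints.intermediateField I : IntermediateField K N)
    have hItop : P.asIdeal.inertia I = ⊤ :=
      eq_top_iff.mpr fun σ _ ↦ Ideal.coe_mem_inertia.mp σ.2
    -- Since `N/L` is unramified at `P`, a uniformizer of `p` is one at `P`. Over the inertia field
    -- `E` it detects whether the lift `σ` is in the second ramification group.
    obtain ⟨π, hπ⟩ := p.intValuation_exists_uniformizer
    have hπ1 : π ∈ p.asIdeal ^ 1 := by
      rw [← p.intValuation_le_pow_iff_mem, hπ]; rfl
    have hπ2 : π ∉ p.asIdeal ^ 2 := by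
      rw [← p.intValuation_le_pow_iff_mem, hπ, WithZero.exp_le_exp]
      norm_num
    have hm (n : ℕ) (x : 𝓞 L) : algebraMap (𝓞 L) (𝓞 N) x ∈ P.asIdeal ^ n ↔ x ∈ p.asIdeal ^ n := by
      rw [← Ideal.mem_comap]
      exact (congrArg (x ∈ ·) (hpow n)).to_iff
    have h1 := (mem_inertia_pow_iff (G := I) E P.ne_bot hItop
      (by simpa using (hm 1 π).mpr hπ1) (mt (hm 2 π).mp hπ2) 3 ⟨σ, hσ⟩).mpr (by
        change σ • algebraMap (𝓞 L) (𝓞 N) π - _ ∈ _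
        rw [← algebraMap_restrictNormalHom_smul, ← map_sub, hm]
        exact hτ π)
    have h2 : σ ∈ (P.asIdeal ^ 3).inertia Gal(N/K) := h1
    rw [h, Subgroup.mem_bot] at h2
    rw [h2, map_one, Subgroup.mem_bot]
  · rw [eq_bot_iff]
    intro σ hσ
    rw [Subgroup.mem_bot]
    refine injective_restrictNormalHom_inertia (L₁ := L₁) hinj P he
      (fun x ↦ Ideal.pow_le_self three_ne_zero (hσ x)) ?_
    rw [← Subgroup.mem_bot, ← h, ← hpow]
    exact restrictNormalHom_mem_inertia hσ

end Compositum

/-! ### Products of weakly ramified homomorphisms. -/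

section WeaklyRamified

variable {K : Type*} [Field K] [NumberField K]
  {G : Type*} [CommGroup G] [TopologicalSpace G] [DiscreteTopology G]

theorem inertia_pow_three_eq_bot_of_unramified {h₁ h₂ : GaloisHom K G} (hw : IsWeaklyRamified h₂)
    {v : HeightOneSpectrum (𝓞 K)} (hv : v ∉ ramifiedPrimes h₁) {P : Ideal (𝓞 (fieldOf (h₁ * h₂)))}
    [hP : P.IsPrime] [P.LiesOver v.asIdeal] :
    (P ^ 3).inertia Gal(fieldOf (h₁ * h₂)/K) = ⊥ := by
  -- The field of `H` is the compositum of the fields of `h₁` and `h₂`, and also of `h₁` and `h₁ *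
  -- h₂`. As `h₁` is unramified at `v`, passing through it compares `h₁ * h₂` with `h₂`.
  let H : GaloisHom K (G × G) := h₁.prod h₂
  have hH (ω) : H ω = (h₁ ω, h₂ ω) := rfl
  have le₁ : fieldOf h₁ ≤ fieldOf H := fun y hy ↦ mem_fieldOf_iff.mpr fun ω hω ↦
    mem_fieldOf_iff.mp hy ω (congrArg Prod.fst hω)
  have le₂ : fieldOf h₂ ≤ fieldOf H := fun y hy ↦ mem_fieldOf_iff.mpr fun ω hω ↦
    mem_fieldOf_iff.mp hy ω (congrArg Prod.snd hω)
  have le₃ : fieldOf (h₁ * h₂) ≤ fieldOf H := fun y hy ↦ mem_fieldOf_iff.mpr fun ω hω ↦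
    mem_fieldOf_iff.mp hy ω (by
      rw [galoisHom_mul_apply, show h₁ ω = 1 from congrArg Prod.fst hω,
        show h₂ ω = 1 from congrArg Prod.snd hω, one_mul])
  let := (IntermediateField.inclusion le₁).toRingHom.toAlgebra
  let := (IntermediateField.inclusion le₂).toRingHom.toAlgebra
  let := (IntermediateField.inclusion le₃).toRingHom.toAlgebra
  have : IsScalarTower K (fieldOf h₁) (fieldOf H) := .of_algebraMap_eq fun _ ↦ rfl
  have : IsScalarTower K (fieldOf h₂) (fieldOf H) := .of_algebraMap_eq fun _ ↦ rfl
  have : IsScalarTower K (fieldOf (h₁ * h₂)) (fieldOf H) := .of_algebraMap_eq fun _ ↦ rfl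
  have key (h : GaloisHom K G) [Algebra (fieldOf h) (fieldOf H)]
      [IsScalarTower K (fieldOf h) (fieldOf H)]
      (hc : ∀ a : fieldOf h, (algebraMap (fieldOf h) (fieldOf H) a : AlgebraicClosure K) = a)
      (ω : Gal(AlgebraicClosure K/K)) (hω : AlgEquiv.restrictNormalHom (fieldOf h)
        (AlgEquiv.restrictNormalHom (fieldOf H) ω) = 1) : h ω = 1 := by
    rw [← restrictNormalHom_eq_one_iff]
    ext a
    have h1 := AlgEquiv.restrictNormal_commutes (AlgEquiv.restrictNormalHom (fieldOf H) ω)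
      (fieldOf h) a
    have h2 : AlgEquiv.restrictNormal (AlgEquiv.restrictNormalHom (fieldOf H) ω)
      (fieldOf h) = 1 := hω
    rw [h2, AlgEquiv.one_apply] at h1
    have h3 := congrArg (Subtype.val) h1
    rw [coe_restrictNormalHom_apply, hc] at h3
    rw [coe_restrictNormalHom_apply, AlgEquiv.one_apply, ← h3]
  obtain ⟨⟨Q₀, hQ₀, hQP⟩⟩ := P.nonempty_primesOver (S := 𝓞 (fieldOf H))
  have hP0 : P ≠ ⊥ := Ideal.ne_bot_of_liesOver_of_ne_bot v.ne_bot P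
  let Q : HeightOneSpectrum (𝓞 (fieldOf H)) :=
    ⟨Q₀, hQ₀, Ideal.ne_bot_of_liesOver_of_ne_bot hP0 Q₀⟩
  have hQv : Q₀.LiesOver v.asIdeal := Ideal.LiesOver.trans Q₀ P v.asIdeal
  have hQ1 : Q.asIdeal.LiesOver (Q.asIdeal.under (𝓞 (fieldOf h₁))) := ⟨rfl⟩
  have hQ1v : (Q.asIdeal.under (𝓞 (fieldOf h₁))).LiesOver v.asIdeal :=
    Ideal.LiesOver.tower_bot Q.asIdeal _ v.asIdeal
  have he : (Q.asIdeal.under (𝓞 (fieldOf h₁))).ramificationIdx (𝓞 K) = 1 := by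
    by_contra he
    exact hv ⟨_, inferInstance, hQ1v, he⟩
  have hPQ : P = Q.asIdeal.under (𝓞 (fieldOf (h₁ * h₂))) := hQP.over
  rw [hPQ, ← inertia_pow_three_eq_bot_iff (N := fieldOf H) (L₁ := fieldOf h₁) ?_ Q he,
    inertia_pow_three_eq_bot_iff (L := fieldOf h₂) (L₁ := fieldOf h₁) ?_ Q he]
  · exact hw _ inferInstance (mt Ideal.eq_bot_of_comap_eq_bot Q.ne_bot)
  · intro σ h1 h2
    obtain ⟨ω, rfl⟩ := restrictNormalHom_fieldOf_surjective H σ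
    rw [restrictNormalHom_eq_one_iff, hH, key h₁ (fun _ ↦ rfl) ω h1, key h₂ (fun _ ↦ rfl) ω h2]
    rfl
  · intro σ h1 h2
    obtain ⟨ω, rfl⟩ := restrictNormalHom_fieldOf_surjective H σ
    have h3 := key (h₁ * h₂) (fun _ ↦ rfl) ω h2
    rw [galoisHom_mul_apply, key h₁ (fun _ ↦ rfl) ω h1, one_mul] at h3
    rw [restrictNormalHom_eq_one_iff, hH, key h₁ (fun _ ↦ rfl) ω h1, h3]
    rfl

theorem IsWeaklyRamified.mul {h₁ h₂ : GaloisHom K G} (hw₁ : IsWeaklyRamified h₁)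
    (hw₂ : IsWeaklyRamified h₂) (hd : ramifiedPrimes h₁ ∩ ramifiedPrimes h₂ = ∅) :
    IsWeaklyRamified (h₁ * h₂) := by
  intro P hP hP0
  let v : HeightOneSpectrum (𝓞 K) :=
    ⟨P.under (𝓞 K), inferInstance, mt Ideal.eq_bot_of_comap_eq_bot hP0⟩
  have hPv : P.LiesOver v.asIdeal := ⟨rfl⟩
  by_cases hv : v ∈ ramifiedPrimes h₁
  · have hv' : v ∉ ramifiedPrimes h₂ := fun h ↦ Set.notMem_empty v (hd ▸ ⟨hv, h⟩)
    clear hd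
    revert P
    rw [mul_comm h₁ h₂]
    intro P hP hP0 v hPv hv hv'
    exact inertia_pow_three_eq_bot_of_unramified hw₁ hv'
  · exact inertia_pow_three_eq_bot_of_unramified hw₂ hv

end WeaklyRamified

/-! ### The trace at an unramified prime. -/

section Unramified

variable {K L : Type*} [Field K] [NumberField K] [Field L] [NumberField L] [Algebra K L]

/-- If `Tr(D) ⊆ v`, then `D v⁻¹ ⊆ D⁻¹`. At `P` the different has valuation 0 and `v⁻¹` has valuation
-1, a contradiction. -/
theorem exists_trace_notMem_of_ramificationIdx_eq_one (v : HeightOneSpectrum (𝓞 K))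
    (P : HeightOneSpectrum (𝓞 L)) [P.asIdeal.LiesOver v.asIdeal]
    (he : P.asIdeal.ramificationIdx (𝓞 K) = 1) :
    ∃ u ∈ differentIdeal (𝓞 K) (𝓞 L), ∃ t : 𝓞 K, (t : K) = Algebra.trace K L u ∧
      t ∉ v.asIdeal := by
  by_contra! H
  have hD0 : differentIdeal (𝓞 K) (𝓞 L) ≠ ⊥ := differentIdeal_ne_bot
  have hD := (FractionalIdeal.coeIdeal_ne_zero (K := L)).mpr hD0
  have hv0 : (v.asIdeal : FractionalIdeal (𝓞 K)⁰ K) ≠ 0 :=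
    FractionalIdeal.coeIdeal_ne_zero.mpr v.ne_bot
  have hvi : ((v.asIdeal : FractionalIdeal (𝓞 K)⁰ K)⁻¹).extendedHom L (𝓞 L) ≠ 0 :=
    mt (FractionalIdeal.extendedHom_eq_zero_iff L (𝓞 L)).mp (inv_ne_zero hv0)
  have h1 : (differentIdeal (𝓞 K) (𝓞 L) : FractionalIdeal (𝓞 L)⁰ L) *
      ((v.asIdeal : FractionalIdeal (𝓞 K)⁰ K)⁻¹).extendedHom L (𝓞 L) ≤ inverseDifferent K L := by
    refine mul_extendedHom_le_inverseDifferent fun x hx y hy ↦ ?_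
    obtain ⟨u, hu, rfl⟩ := (FractionalIdeal.mem_coeIdeal _).mp hx
    refine (FractionalIdeal.mem_one_iff _).mp ((FractionalIdeal.mem_inv_iff hv0).mp hy _ ?_)
    have ht : ((Algebra.intTrace (𝓞 K) (𝓞 L) u : 𝓞 K) : K) = Algebra.trace K L u :=
      Algebra.algebraMap_intTrace u
    exact (FractionalIdeal.mem_coeIdeal _).mpr ⟨_, H u hu _ ht, ht⟩
  have h2 := FractionalIdeal.count_mono L P (mul_ne_zero hD hvi) h1
  rw [FractionalIdeal.count_mul L P hD hvi, count_extendedHom P v, he, FractionalIdeal.count_inv,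
    FractionalIdeal.count_self, inverseDifferent, FractionalIdeal.count_inv] at h2
  rw [ramificationIdx_eq_one_iff_not_dvd_differentIdeal, Ideal.dvd_iff_le, ← pow_one P.asIdeal,
    ← natCast_le_count_coe_iff L P hD0] at he
  push_cast at h2 he
  omega

end Unramified

/-! ### Multiplicativity for disjoint ramification. -/

section Multiplicative

variable {K : Type*} [Field K] [NumberField K]

variable (K) in
/-- The algebraic integers in `K^c`. -/
def integralValues : Submodule (𝓞 K) (AlgebraicClosure K) where
  carrier := {y | IsIntegral ℤ y}
  add_mem' := IsIntegral.add
  zero_mem' := isIntegral_zero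
  smul_mem' r y hy := by
    rw [Algebra.smul_def]
    exact IsIntegral.mul ((RingOfIntegers.isIntegral_coe r).algebraMap) hy

theorem exists_coe_eq_of_mem_integralValues {L : IntermediateField K (AlgebraicClosure K)}
    {y : AlgebraicClosure K} (hy : y ∈ integralValues K) (hyL : y ∈ L) :
    ∃ z : 𝓞 L, ((z : L) : AlgebraicClosure K) = y := by
  have h : IsIntegral ℤ (⟨y, hyL⟩ : L) :=
    (isIntegral_algebraMap_iff (algebraMap L (AlgebraicClosure K)).injective).mp hy
  exact ⟨⟨_, h⟩, rfl⟩

theorem coe_mem_integralValues {L : IntermediateField K (AlgebraicClosure K)} (z : 𝓞 L) :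
    ((z : L) : AlgebraicClosure K) ∈ integralValues K :=
  (RingOfIntegers.isIntegral_coe z).algebraMap (B := AlgebraicClosure K)

variable {G : Type*} [CommGroup G] [TopologicalSpace G] [DiscreteTopology G] [Fintype G]

/-- The integral elements of `K_h` as a lattice in `K^c[G]`. -/
noncomputable def integralLattice (h : GaloisHom K G) :
    Submodule (GroupRing K G) (ClosureGroupRing K G) :=
  lattice h (integralValues K)

theorem integralLattice_mul_le (h h' : GaloisHom K G) :
    integralLattice h * integralLattice h' ≤ integralLattice (h * h') :=
  lattice_mul_le fun _ ha _ hb ↦ IsIntegral.mul ha hb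

theorem ofField_mem_integralLattice (h : GaloisHom K G) (a : 𝓞 (fieldOf h)) :
    ofField h a ∈ integralLattice h :=
  ofField_mem_lattice h fun σ ↦ coe_mem_integralValues (σ • a)

/-- Says that the lattice of integral elements is invertible at an unramified `v`. The dual basis
collapses `∑ (u a_i) · b_i` to `Tr(u)` at the identity, and `u ∈ D` can be chosen with `Tr(u) ∉ v`.
-/
theorem exists_single_mem_integralLattice_mul {h : GaloisHom K G} {v : HeightOneSpectrum (𝓞 K)}
    (hv : v ∉ ramifiedPrimes h) : ∃ z ∉ v.asIdeal,
      algebraMap (GroupRing K G) (ClosureGroupRing K G) (MonoidAlgebra.single 1 z) ∈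
        integralLattice h * integralLattice h⁻¹ := by
  classical
  have := v.isPrime
  obtain ⟨⟨P₀, hP₀, hPv⟩⟩ := v.asIdeal.nonempty_primesOver (S := 𝓞 (fieldOf h))
  let P : HeightOneSpectrum (𝓞 (fieldOf h)) :=
    ⟨P₀, hP₀, Ideal.ne_bot_of_liesOver_of_ne_bot v.ne_bot P₀⟩
  have : P.asIdeal.LiesOver v.asIdeal := hPv
  have he : P.asIdeal.ramificationIdx (𝓞 K) = 1 := by
    by_contra he
    exact hv ⟨P₀, hP₀, hPv, he⟩
  obtain ⟨u, hu, t, ht, htv⟩ := exists_trace_notMem_of_ramificationIdx_eq_one v P he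
  refine ⟨t, htv, ?_⟩
  obtain ⟨n, a, b, ha, hab⟩ := exists_finset_sum_trace_mul_eq K (fieldOf h)
  choose e he using fun i ↦ exists_coe_eq_mul_of_mem_differentIdeal hu (ha i)
  have key (σ : Gal(fieldOf h/K)) : ∑ i, MonoidAlgebra.single (galHom h σ) (algebraMap K
      (AlgebraicClosure K) (Algebra.trace K (fieldOf h) (e i * σ (b i)))) =
      MonoidAlgebra.single (galHom h σ) (algebraMap K (AlgebraicClosure K)
        (Algebra.trace K (fieldOf h) (u * if σ = 1 then 1 else 0))) := by
    refine (map_sum (MonoidAlgebra.singleAddHom _) _ _).symm.trans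
      (congrArg (MonoidAlgebra.single _) ?_)
    rw [← map_sum, ← map_sum, ← sum_mul_apply_eq_ite hab σ, Finset.mul_sum]
    simp_rw [he, mul_assoc]
  have h1 : ∑ i, ofField h (e i) * antipode K G (ofField h (b i)) =
      MonoidAlgebra.single 1 (algebraMap K (AlgebraicClosure K) t) := by
    simp_rw [ofField_mul_antipode_ofField]
    rw [Finset.sum_comm, Finset.sum_congr rfl fun σ _ ↦ key σ, Finset.sum_eq_single 1]
    · rw [if_pos rfl, mul_one, ← ht, map_one]
    · intro σ _ hσ
      rw [if_neg hσ, mul_zero, map_zero, map_zero, MonoidAlgebra.single_zero]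
    · exact fun h ↦ absurd (Finset.mem_univ _) h
  have h2 : algebraMap (GroupRing K G) (ClosureGroupRing K G) (MonoidAlgebra.single 1 t) =
      ∑ i, ofField h (e i) * antipode K G (ofField h (b i)) := by
    rw [h1, algebraMap_single]
    rfl
  rw [h2]
  exact sum_mem fun i _ ↦ Submodule.mul_mem_mul (ofField_mem_integralLattice h _)
    (antipode_mem_lattice (ofField_mem_integralLattice h _))

/-- It suffices to find, for each `v`, a multiplier outside `v`. If `h₁` is unramified at `v`, take
`z ∈ O_{h₁} O_{h₁⁻¹}`; then `z x ∈ O_{h₁} O_{h₁⁻¹} O_{h₁h₂} ⊆ O_{h₁} O_{h₂}`. Otherwise `h₂` is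
unramified there. -/
theorem integralLattice_mul {h₁ h₂ : GaloisHom K G}
    (hd : ramifiedPrimes h₁ ∩ ramifiedPrimes h₂ = ∅) :
    integralLattice (h₁ * h₂) = integralLattice h₁ * integralLattice h₂ := by
  refine le_antisymm (fun x hx ↦ ?_) (integralLattice_mul_le h₁ h₂)
  let I : Ideal (GroupRing K G) := (integralLattice h₁ * integralLattice h₂).comap
    (LinearMap.toSpanSingleton (GroupRing K G) (ClosureGroupRing K G) x)
  let J : Ideal (𝓞 K) := I.comap (MonoidAlgebra.singleOneRingHom : 𝓞 K →+* GroupRing K G)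
  have hJ (z : 𝓞 K) : z ∈ J ↔ (MonoidAlgebra.single 1 z : GroupRing K G) • x ∈
    integralLattice h₁ * integralLattice h₂ := Iff.rfl
  suffices hJ1 : (1 : 𝓞 K) ∈ J by
    rw [hJ, ← MonoidAlgebra.one_def, one_smul] at hJ1
    exact hJ1
  rw [← Ideal.eq_top_iff_one]
  by_contra hJt
  obtain ⟨m, hm, hJm⟩ := Ideal.exists_le_maximal J hJt
  let v : HeightOneSpectrum (𝓞 K) :=
    ⟨m, hm.isPrime, Ring.ne_bot_of_isMaximal_of_not_isField hm (RingOfIntegers.not_isField K)⟩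
  by_cases hv : v ∈ ramifiedPrimes h₁
  · have hv' : v ∉ ramifiedPrimes h₂ := fun h ↦ Set.notMem_empty v (hd ▸ ⟨hv, h⟩)
    obtain ⟨z, hzv, hz⟩ := exists_single_mem_integralLattice_mul hv'
    refine hzv (hJm ((hJ z).mpr ?_))
    rw [Algebra.smul_def]
    have h1 := Submodule.mul_mem_mul hz hx
    rw [mul_assoc] at h1
    rw [mul_comm (integralLattice h₁)]
    refine mul_le_mul' le_rfl ((integralLattice_mul_le _ _).trans_eq ?_) h1
    rw [mul_comm h₁ h₂, inv_mul_cancel_left]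
  · obtain ⟨z, hzv, hz⟩ := exists_single_mem_integralLattice_mul hv
    refine hzv (hJm ((hJ z).mpr ?_))
    rw [Algebra.smul_def]
    have h1 := Submodule.mul_mem_mul hz hx
    rw [mul_assoc] at h1
    refine mul_le_mul' le_rfl ((integralLattice_mul_le _ _).trans_eq ?_) h1
    rw [inv_mul_cancel_left]

/-- The pointwise product of two elements of `K^c[G]`. -/
noncomputable def pointwiseMul (x y : ClosureGroupRing K G) : ClosureGroupRing K G :=
  .ofCoeff (x.coeff * y.coeff)

@[simp]
theorem coeff_pointwiseMul (x y : ClosureGroupRing K G) (t : G) :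
    (pointwiseMul x y).coeff t = x.coeff t * y.coeff t := rfl

theorem add_pointwiseMul (x x' y : ClosureGroupRing K G) :
    pointwiseMul (x + x') y = pointwiseMul x y + pointwiseMul x' y := by
  ext t
  simp [add_mul]

theorem pointwiseMul_add (x y y' : ClosureGroupRing K G) :
    pointwiseMul x (y + y') = pointwiseMul x y + pointwiseMul x y' := by
  ext t
  simp [mul_add]

/-- The two convolution sums run over independent `s` and `u`; put `u = g s`. The identity makes
`A_{h₁} A_{h₂}` stable under pointwise multiplication by `O_{h₁} O_{h₂}`. -/
theorem pointwiseMul_mul_mul (x y a b : ClosureGroupRing K G) :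
    pointwiseMul (x * y) (a * b) = ∑ g : G,
      pointwiseMul x (MonoidAlgebra.single g⁻¹ 1 * a) *
        pointwiseMul y (MonoidAlgebra.single g 1 * b) := by
  ext t
  rw [coeff_pointwiseMul, coeff_mul_eq_sum, coeff_mul_eq_sum, MonoidAlgebra.coeff_sum,
    Finsupp.finsetSum_apply]
  simp_rw [coeff_mul_eq_sum _ _ t, coeff_pointwiseMul, MonoidAlgebra.coeff_single_mul_apply]
  rw [Finset.sum_mul, Finset.sum_comm]
  refine Finset.sum_congr rfl fun s _ ↦ ?_
  rw [Finset.mul_sum, ← Equiv.sum_comp (Equiv.mulRight s)]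
  refine Finset.sum_congr rfl fun g _ ↦ ?_
  simp only [Equiv.coe_mulRight, inv_inv, mul_inv, mul_assoc g⁻¹]
  ring

theorem pointwiseMul_mem_sqrtIdeal {h : GaloisHom K G} {x a : ClosureGroupRing K G}
    (hx : x ∈ integralLattice h) (ha : a ∈ sqrtIdeal h) : pointwiseMul x a ∈ sqrtIdeal h := by
  refine ⟨fun ω t ↦ ?_, fun t ↦ ?_⟩
  · rw [coeff_pointwiseMul, coeff_pointwiseMul, map_mul ω, hx.1, ha.1]
  · obtain ⟨z, hz⟩ := exists_coe_eq_of_mem_integralValues (hx.2 t) (mem_fieldOf_of_mem_lattice hx t)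
    obtain ⟨b, hb, hba⟩ := ha.2 t
    refine ⟨z • b, Submodule.smul_mem _ _ hb, ?_⟩
    rw [coeff_pointwiseMul, ← hz, ← hba, Algebra.smul_def]
    rfl

theorem single_mul_mem {N : Submodule (GroupRing K G) (ClosureGroupRing K G)}
    {x : ClosureGroupRing K G} (hx : x ∈ N) (g : G) : MonoidAlgebra.single g 1 * x ∈ N := by
  have := N.smul_mem (MonoidAlgebra.single g 1) hx
  rwa [Algebra.smul_def, algebraMap_single, map_one] at this

theorem pointwiseMul_mem_mul {h₁ h₂ : GaloisHom K G} {x f : ClosureGroupRing K G}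
    (hx : x ∈ integralLattice h₁ * integralLattice h₂) (hf : f ∈ sqrtIdeal h₁ * sqrtIdeal h₂) :
    pointwiseMul x f ∈ sqrtIdeal h₁ * sqrtIdeal h₂ := by
  induction hx using Submodule.mul_induction_on' with
  | mem_mul_mem x hx y hy =>
    induction hf using Submodule.mul_induction_on' with
    | mem_mul_mem a ha b hb =>
      rw [pointwiseMul_mul_mul]
      exact sum_mem fun g _ ↦ Submodule.mul_mem_mul
        (pointwiseMul_mem_sqrtIdeal hx (single_mul_mem ha _))
        (pointwiseMul_mem_sqrtIdeal hy (single_mul_mem hb _))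
    | add a _ b _ ha hb =>
      rw [pointwiseMul_add]
      exact add_mem ha hb
  | add x _ y _ hx hy =>
    rw [add_pointwiseMul]
    exact add_mem hx hy

theorem antipode_mem_mul {h₁ h₂ : GaloisHom K G} {f : ClosureGroupRing K G}
    (hf : f ∈ sqrtIdeal h₁ * sqrtIdeal h₂) :
    antipode K G f ∈ sqrtIdeal h₁⁻¹ * sqrtIdeal h₂⁻¹ := by
  induction hf using Submodule.mul_induction_on' with
  | mem_mul_mem a ha b hb =>
    rw [map_mul]
    exact Submodule.mul_mem_mul (antipode_mem_sqrtIdeal ha) (antipode_mem_sqrtIdeal hb)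
  | add a _ b _ ha hb =>
    rw [map_add]
    exact add_mem ha hb

theorem antipode_antipode (x : ClosureGroupRing K G) : antipode K G (antipode K G x) = x := by
  ext t
  simp

theorem sqrtIdeal_mul_le (hG : Odd (Nat.card G)) {h₁ h₂ : GaloisHom K G}
    (hw₁ : IsWeaklyRamified h₁) (hw₂ : IsWeaklyRamified h₂)
    (hd : ramifiedPrimes h₁ ∩ ramifiedPrimes h₂ = ∅) :
    sqrtIdeal h₁ * sqrtIdeal h₂ ≤ sqrtIdeal (h₁ * h₂) := by
  classical
  intro f hf
  set h := h₁ * h₂ with hh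
  have hA := sqrtInverseDifferent_sq_of_isWeaklyRamified hG (hw₁.mul hw₂ hd)
  rw [← hh] at hA
  have hfl : f ∈ lattice h ⊤ := lattice_mul_le (fun _ _ _ _ ↦ Submodule.mem_top) hf
  refine ⟨hfl.1, fun s ↦ ?_⟩
  let y : fieldOf h := ⟨f.coeff s, mem_fieldOf_of_mem_lattice hfl s⟩
  refine ⟨y, mem_of_sq_mem_sq ?_, rfl⟩
  rw [hA, mem_inverseDifferent_iff]
  intro a
  -- `x` has the value `σ a` at `s h(σ)⁻¹`, where `f` has the value `σ y`, and vanishes elsewhere.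
  -- So the coefficient at 1 of `pointwiseMul x f * antipode K G f` is `Tr(a y²)`.
  let x : ClosureGroupRing K G := MonoidAlgebra.single s 1 * ofField h a
  have hx : x ∈ integralLattice h₁ * integralLattice h₂ := by
    rw [← integralLattice_mul hd]
    exact single_mul_mem (ofField_mem_integralLattice h a) s
  have h1 : pointwiseMul x f * antipode K G f ∈
      (1 : Submodule (GroupRing K G) (ClosureGroupRing K G)) := by
    have h2 := Submodule.mul_mem_mul (pointwiseMul_mem_mul hx hf) (antipode_mem_mul hf)
    rwa [mul_mul_mul_comm, show sqrtIdeal h₁ * sqrtIdeal h₁⁻¹ = 1 from (sqrtUnit hG hw₁).val_inv,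
      show sqrtIdeal h₂ * sqrtIdeal h₂⁻¹ = 1 from (sqrtUnit hG hw₂).val_inv, one_mul] at h2
  obtain ⟨r, hr⟩ := mem_one_iff.mp h1 1
  refine ⟨r, (algebraMap K (AlgebraicClosure K)).injective (Eq.trans hr ?_)⟩
  rw [IsScalarTower.algebraMap_apply K (fieldOf h), trace_eq_sum_automorphisms, map_sum,
    coeff_mul_eq_sum, ← Equiv.sum_comp (Equiv.mulLeft s)]
  simp_rw [coeff_pointwiseMul, x, MonoidAlgebra.coeff_single_mul_apply, coeff_antipode,
    Equiv.coe_mulLeft, inv_mul_cancel_left, mul_one, inv_inv, one_mul, coeff_ofField,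
    Finset.sum_mul]
  rw [Finset.sum_comm]
  refine Finset.sum_congr rfl fun σ _ ↦ ?_
  simp_rw [ite_mul, zero_mul]
  rw [Finset.sum_ite_eq, if_pos (Finset.mem_univ _)]
  obtain ⟨ω, rfl⟩ := restrictNormalHom_fieldOf_surjective h σ
  have h3 : f.coeff (s * (h ω)⁻¹) = AlgEquiv.restrictNormalHom (fieldOf h) ω y := by
    rw [mul_comm, hfl.1, coe_restrictNormalHom_apply]
  rw [galHom_restrictNormalHom, h3, map_mul, map_pow, map_mul, map_pow]
  simp only [IntermediateField.algebraMap_apply]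
  ring

/-- Applying the antipode to the inclusion gives the same inclusion for the inverse lattices; for
invertible lattices the two force equality. -/
theorem sqrtIdeal_mul (hG : Odd (Nat.card G)) {h₁ h₂ : GaloisHom K G}
    (hw₁ : IsWeaklyRamified h₁) (hw₂ : IsWeaklyRamified h₂)
    (hd : ramifiedPrimes h₁ ∩ ramifiedPrimes h₂ = ∅) :
    sqrtIdeal (h₁ * h₂) = sqrtIdeal h₁ * sqrtIdeal h₂ := by
  have hle := sqrtIdeal_mul_le hG hw₁ hw₂ hd
  refine le_antisymm ?_ hle
  have h1 : sqrtIdeal h₁⁻¹ * sqrtIdeal h₂⁻¹ ≤ sqrtIdeal (h₁ * h₂)⁻¹ := by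
    intro y hy
    have h2 := antipode_mem_mul hy
    rw [inv_inv, inv_inv] at h2
    rw [← antipode_antipode y]
    exact antipode_mem_sqrtIdeal (hle h2)
  have h2 : (sqrtIdeal h₁ * sqrtIdeal h₂) * (sqrtIdeal h₁⁻¹ * sqrtIdeal h₂⁻¹) = 1 := by
    rw [mul_mul_mul_comm, show sqrtIdeal h₁ * sqrtIdeal h₁⁻¹ = 1 from (sqrtUnit hG hw₁).val_inv,
      show sqrtIdeal h₂ * sqrtIdeal h₂⁻¹ = 1 from (sqrtUnit hG hw₂).val_inv, one_mul]
  calc sqrtIdeal (h₁ * h₂) = sqrtIdeal (h₁ * h₂) * (sqrtIdeal h₁⁻¹ * sqrtIdeal h₂⁻¹) *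
        (sqrtIdeal h₁ * sqrtIdeal h₂) := by rw [mul_assoc, mul_comm (sqrtIdeal h₁⁻¹ * _), h2, mul_one]
    _ ≤ sqrtIdeal (h₁ * h₂) * sqrtIdeal (h₁ * h₂)⁻¹ * (sqrtIdeal h₁ * sqrtIdeal h₂) :=
        mul_le_mul' (mul_le_mul' le_rfl h1) le_rfl
    _ = sqrtIdeal h₁ * sqrtIdeal h₂ := by
        rw [show sqrtIdeal (h₁ * h₂) * sqrtIdeal (h₁ * h₂)⁻¹ = 1 from
          (sqrtUnit hG (hw₁.mul hw₂ hd)).val_inv, one_mul]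

theorem galA_mul (hG : Odd (Nat.card G)) {h₁ h₂ : GaloisHom K G}
    (hw₁ : IsWeaklyRamified h₁) (hw₂ : IsWeaklyRamified h₂)
    (hd : ramifiedPrimes h₁ ∩ ramifiedPrimes h₂ = ∅) :
    galA (h₁ * h₂) = galA h₁ * galA h₂ := by
  rw [galA_eq_sqrtClass hG hw₁, galA_eq_sqrtClass hG hw₂,
    galA_eq_sqrtClass hG (hw₁.mul hw₂ hd)]
  have : sqrtUnit hG (hw₁.mul hw₂ hd) = sqrtUnit hG hw₁ * sqrtUnit hG hw₂ :=
    Units.ext (sqrtIdeal_mul hG hw₁ hw₂ hd)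
  refine Subtype.ext ?_
  simp only [sqrtClass, this, map_mul]
  rfl

end Multiplicative

end SqrtInvDiff

theorem theorem1p2 (K : Type*) [Field K] [NumberField K]
    (G : Type*) [CommGroup G] [Finite G] [TopologicalSpace G] [DiscreteTopology G]
    (hG : Odd (Nat.card G)) :
    -- `A_h` and its class `gal_A(h)` are well defined for weakly ramified `h`
    (∀ h : SqrtInvDiff.GaloisHom K G, SqrtInvDiff.IsWeaklyRamified h →
      SqrtInvDiff.sqrtInverseDifferent K (SqrtInvDiff.fieldOf h) ^ 2 =
          SqrtInvDiff.inverseDifferent K (SqrtInvDiff.fieldOf h) ∧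
        SqrtInvDiff.IsLocallyFree K G (SqrtInvDiff.SqrtModule h) ∧
        SqrtInvDiff.IsClassOf (SqrtInvDiff.galA h) (SqrtInvDiff.SqrtModule h)) ∧
    -- compatibility with inverses
    (∀ h : SqrtInvDiff.GaloisHom K G, SqrtInvDiff.IsWeaklyRamified h →
      SqrtInvDiff.IsWeaklyRamified h⁻¹ ∧
        SqrtInvDiff.galA h⁻¹ = (SqrtInvDiff.galA h)⁻¹) ∧
    -- weak multiplicativity
    (∀ h₁ h₂ : SqrtInvDiff.GaloisHom K G,
      SqrtInvDiff.IsWeaklyRamified h₁ → SqrtInvDiff.IsWeaklyRamified h₂ →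
      SqrtInvDiff.ramifiedPrimes h₁ ∩ SqrtInvDiff.ramifiedPrimes h₂ = ∅ →
      SqrtInvDiff.IsWeaklyRamified (h₁ * h₂) ∧
        SqrtInvDiff.galA (h₁ * h₂) = SqrtInvDiff.galA h₁ * SqrtInvDiff.galA h₂) := by
  have := Fintype.ofFinite G
  refine ⟨fun h hw ↦ ⟨SqrtInvDiff.sqrtInverseDifferent_sq_of_isWeaklyRamified hG hw,
    SqrtInvDiff.isLocallyFree_sqrtModule hG hw, ?_⟩,
    fun h hw ↦ ⟨hw.inv, SqrtInvDiff.galA_inv hG hw⟩,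
    fun h₁ h₂ hw₁ hw₂ hd ↦ ⟨hw₁.mul hw₂ hd, SqrtInvDiff.galA_mul hG hw₁ hw₂ hd⟩⟩
  exact SqrtInvDiff.isClassOf_cl (SqrtInvDiff.isClassOf_sqrtClass hG hw)
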